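/- Let $K$ be a field and let $m\ge 4$ be an integer. Let $C_m\subset\mathbb A^4(K)$ be the monomial curve $x_i=t^{n_i}$ with $(n_1,n_2,n_3,n_4)=(2m+1,\;2m+3,\;2m^2+m-2,\;2m^2+m-1)$, let $I(C_m)$ be its toric ideal, i.e. the kernel of $K[x_1,\dots,x_4]\to K[t]$, $x_i\mapsto t^{n_i}$, let $R_m$ be the local ring of $C_m$ at the origin, with maximal ideal $\mathfrak m$, and let $I(C_m)_*$ be the ideal generated by the homogeneous summands $f_*$ of least degree of the polynomials $f\in I(C_m)$, so that $K[x_1,\dots,x_4]/I(C_m)_*$ is the coordinate ring of the tangent cone of $C_m$ at the origin. Then: 1. $I(C_m)$ is minimally generated by $x_1^{m+1}-x_2x_3$, $x_2^m-x_1x_4$, $x_3^2-x_2^{m-1}x_4$, $x_4^2-x_1^mx_3$, $x_1^mx_2^{m-1}-x_3x_4$. 2. $I(C_m)$ is not a complete intersection, while $K[x_1,\dots,x_4]/I(C_m)$ is a Gorenstein ring; in particular $R_m$ is a Gorenstein local ring, and it has Krull dimension one. 3. $I(C_m)_*=\langle x_2x_3,\;x_3^2,\;x_1x_4,\;x_3x_4,\;x_4^2,\;x_2^mx_4,\;x_1^{m+2}x_3,\;x_2^{2m+1}\rangle$,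 and the tangent cone ring $K[x_1,\dots,x_4]/I(C_m)_*$ is not Cohen–Macaulay. 4. The Hilbert series of $K[x_1,\dots,x_4]/I(C_m)_*$ is $$\frac{1+3t+\sum_{i=2}^{m}t^i+t^{m+2}+\sum_{i=m+4}^{2m}t^i}{1-t},$$ whose numerator has no negative coefficients. 5. The Hilbert function $k\mapsto\dim_{R_m/\mathfrak m}\mathfrak m^k/\mathfrak m^{k+1}$ of $R_m$ equals the Hilbert function of $K[x_1,\dots,x_4]/I(C_m)_*$ and is non-decreasing. Thus the question of Rossi, whether the Hilbert function of a one-dimensional Gorenstein local ring is non-decreasing, has a positive answer for the rings $R_m$. -/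

import Mathlib

/-! ### Cohen-Macaulay and Gorenstein rings -/

/-- A Noetherian local ring whose depth equals its Krull dimension: the maximal ideal contains a
regular sequence of length `dim R`. -/
def IsCohenMacaulayLocalRing (R : Type*) [CommRing R] [IsLocalRing R] : Prop :=
  IsNoetherianRing R ∧
    ∃ rs : List R, (∀ r ∈ rs, r ∈ IsLocalRing.maximalIdeal R) ∧
      RingTheory.Sequence.IsRegular R rs ∧ (rs.length : WithBot ℕ∞) = ringKrullDim R

/-- A Noetherian ring all of whose localizations at maximal ideals are Cohen-Macaulay. -/
def IsCohenMacaulayRing (R : Type*) [CommRing R] : Prop :=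
  IsNoetherianRing R ∧
    ∀ (P : Ideal R) [P.IsMaximal], IsCohenMacaulayLocalRing (Localization.AtPrime P)

/-- A Noetherian local ring `R` with a regular sequence in its maximal ideal `𝔪` modulo which it
becomes an Artinian ring with simple socle (the elements killed by `𝔪`); that is, `R` is
Cohen-Macaulay of type one. -/
def IsGorensteinLocalRing (R : Type*) [CommRing R] [IsLocalRing R] : Prop :=
  IsNoetherianRing R ∧
    ∃ rs : List R, (∀ r ∈ rs, r ∈ IsLocalRing.maximalIdeal R) ∧
      RingTheory.Sequence.IsRegular R rs ∧
      IsArtinianRing (R ⧸ Ideal.ofList rs) ∧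
      IsSimpleModule R
        (Submodule.torsionBySet R (R ⧸ Ideal.ofList rs) (IsLocalRing.maximalIdeal R : Set R))

/-- A Noetherian ring all of whose localizations at maximal ideals are Gorenstein. -/
def IsGorensteinRing (R : Type*) [CommRing R] : Prop :=
  IsNoetherianRing R ∧
    ∀ (P : Ideal R) [P.IsMaximal], IsGorensteinLocalRing (Localization.AtPrime P)

/-! ### Generators of ideals -/

/-- `G` generates `I`, and no proper subset of `G` does. -/
def IsMinimalGeneratingSet {R : Type*} [CommRing R] (I : Ideal R) (G : Set R) : Prop :=
  Ideal.span G = I ∧ ∀ T : Set R, T ⊂ G → Ideal.span T ≠ I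

/-- The ideal `I` can be generated by (at most) `height I` elements. -/
def IsCompleteIntersectionIdeal {R : Type*} [CommRing R] (I : Ideal R) : Prop :=
  ∃ s : Finset R, Ideal.span (s : Set R) = I ∧ (s.card : ℕ∞) ≤ I.height

/-! ### Hilbert functions -/

/-- The Hilbert function `k ↦ dim_{R/𝔪} 𝔪ᵏ/𝔪ᵏ⁺¹` of a local ring. -/
noncomputable def localHilbertFunction (R : Type*) [CommRing R] [IsLocalRing R] (k : ℕ) : ℕ :=
  Module.finrank (R ⧸ IsLocalRing.maximalIdeal R)
    (↥(IsLocalRing.maximalIdeal R ^ k) ⧸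
      (IsLocalRing.maximalIdeal R • ⊤ : Submodule R ↥(IsLocalRing.maximalIdeal R ^ k)))

/-- The Hilbert function of `K[x₁,…,x_d]/J` for a homogeneous ideal `J` (standard grading):
the dimension of the space of residue classes of forms of degree `k`. -/
noncomputable def gradedHilbertFunction {K : Type*} [Field K] {d : ℕ}
    (J : Ideal (MvPolynomial (Fin d) K)) (k : ℕ) : ℕ :=
  Module.finrank K
    ((MvPolynomial.homogeneousSubmodule (Fin d) K k).map (Ideal.Quotient.mkₐ K J).toLinearMap)

/-- The Hilbert series of `K[x₁,…,x_d]/J` for a homogeneous ideal `J`. -/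
noncomputable def gradedHilbertSeries {K : Type*} [Field K] {d : ℕ}
    (J : Ideal (MvPolynomial (Fin d) K)) : PowerSeries ℤ :=
  PowerSeries.mk fun k => (gradedHilbertFunction J k : ℤ)

/-! ### Tangent cones -/

/-- The homogeneous summand `f_*` of `f` of least degree (and `0_* = 0`). -/
noncomputable def initialForm {K : Type*} [Field K] {d : ℕ} (f : MvPolynomial (Fin d) K) :
    MvPolynomial (Fin d) K :=
  MvPolynomial.homogeneousComponent
    (sInf {k : ℕ | MvPolynomial.homogeneousComponent k f ≠ 0}) f

/-- The ideal `I_*` generated by the `f_*` with `f ∈ I`. -/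
noncomputable def initialFormIdeal {K : Type*} [Field K] {d : ℕ}
    (I : Ideal (MvPolynomial (Fin d) K)) : Ideal (MvPolynomial (Fin d) K) :=
  Ideal.span (initialForm '' (I : Set (MvPolynomial (Fin d) K)))

/-! ### Monomial curves -/

namespace MonomialCurve

variable (K : Type*) [Field K] {d : ℕ} (n : Fin d → ℕ)

/-- The homomorphism `K[x₁,…,x_d] → K[t]`, `xᵢ ↦ t ^ nᵢ`. -/
noncomputable def parametrization : MvPolynomial (Fin d) K →+* Polynomial K :=
  (MvPolynomial.aeval fun i => (Polynomial.X : Polynomial K) ^ n i :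
    MvPolynomial (Fin d) K →ₐ[K] Polynomial K).toRingHom

/-- The toric ideal `I(C)` of the monomial curve `xᵢ = t ^ nᵢ`. -/
noncomputable def toricIdeal : Ideal (MvPolynomial (Fin d) K) :=
  RingHom.ker (parametrization K n)

/-- The coordinate ring `K[x₁,…,x_d]/I(C)` of the curve. -/
abbrev CoordinateRing : Type _ :=
  MvPolynomial (Fin d) K ⧸ toricIdeal K n

/-- The value of a regular function of the curve at the point with parameter `t = 0`, which is the
origin when all `nᵢ` are positive. -/
noncomputable def evalOrigin : CoordinateRing K n →+* K :=
  (Polynomial.evalRingHom 0).comp (RingHom.kerLift (parametrization K n))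

/-- The ideal of the origin in the coordinate ring. -/
noncomputable def originIdeal : Ideal (CoordinateRing K n) :=
  RingHom.ker (evalOrigin K n)

instance originIdeal_isPrime : (originIdeal K n).IsPrime :=
  RingHom.ker_isPrime _

/-- The ideal of the origin is generated by the classes of the variables. -/
theorem originIdeal_eq_map (hn : ∀ i, 0 < n i) :
    originIdeal K n = (Ideal.span (Set.range (MvPolynomial.X (R := K)))).map
      (Ideal.Quotient.mk (toricIdeal K n)) := by
  have hC : ∀ f : MvPolynomial (Fin d) K,
      evalOrigin K n (Ideal.Quotient.mk _ f) = MvPolynomial.constantCoeff f := by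
    intro f
    have : (evalOrigin K n).comp (Ideal.Quotient.mk (toricIdeal K n)) =
        MvPolynomial.constantCoeff := by
      apply MvPolynomial.ringHom_ext
      · intro r
        change Polynomial.eval 0 (parametrization K n (MvPolynomial.C r)) = _
        simp [parametrization]
      · intro i
        change Polynomial.eval 0 (parametrization K n (MvPolynomial.X i)) = _
        simp [parametrization, (hn i).ne']
    exact congrArg (fun g => g f) this
  have hspan : Ideal.span (Set.range (MvPolynomial.X (R := K))) =
      RingHom.ker (MvPolynomial.constantCoeff (R := K) (σ := Fin d)) := by
    ext f
    rw [← Set.image_univ, MvPolynomial.mem_ideal_span_X_image, RingHom.mem_ker,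
      MvPolynomial.constantCoeff_eq]
    constructor
    · intro h
      by_contra h0
      obtain ⟨i, -, hi⟩ := h 0 (MvPolynomial.mem_support_iff.2 h0)
      simp at hi
    · intro h u hu
      by_contra! hcon
      have : u = 0 := by ext i; exact hcon i (Set.mem_univ i)
      rw [this, MvPolynomial.mem_support_iff] at hu
      exact hu h
  rw [hspan]
  ext y
  constructor
  · intro hy
    obtain ⟨f, rfl⟩ := Ideal.Quotient.mk_surjective y
    refine Ideal.mem_map_of_mem _ ?_
    rw [RingHom.mem_ker, ← hC f]
    exact hy
  · intro hy
    refine (Ideal.map_le_iff_le_comap.2 ?_ : _ ≤ originIdeal K n) hy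
    intro f hf
    change evalOrigin K n _ = 0
    rw [hC f]
    exact hf

/-- The local ring of the curve at the origin. -/
abbrev LocalRing : Type _ :=
  Localization.AtPrime (originIdeal K n)

/-- The coordinate ring `K[x₁,…,x_d]/I(C)_*` of the tangent cone of the curve at the origin. -/
abbrev TangentConeRing : Type _ :=
  MvPolynomial (Fin d) K ⧸ initialFormIdeal (toricIdeal K n)

end MonomialCurve

/-- The exponents of the curve `C_m`; the subtractions do not truncate for `m ≥ 1`. -/
def familyExponents (m : ℕ) : Fin 4 → ℕ :=
  ![2 * m + 1, 2 * m + 3, 2 * m ^ 2 + m - 2, 2 * m ^ 2 + m - 1]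

/-! ### Exponents and weights -/

-- Two monomials have the same image in K[t] exactly when they have the same weight, so everything
-- is read off from the weight classes of monomials. Modulo the five binomials, each of the eight
-- leading monomials of the tangent cone equals a monomial of the same weight and strictly larger
-- degree (`exists_tail`). Degree is bounded by weight, so this rewriting stops, and it stops at a
-- standard monomial, one divisible by none of the eight. Residues modulo 2m+1 show that a standard
-- monomial is determined by its weight (`Standard.ext`). Hence each weight class contains exactly
-- one standard monomial, and that monomial alone has the largest degree in its class
-- (`Standard.degree_le`).
--
-- Three consequences follow. Monomials of equal weight agree modulo the binomials, so the binomials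
-- generate I. An f in I whose monomials all have degree at least that of a standard u cannot
-- contain u, so I_* is the monomial ideal of the eight leading monomials. The standard monomials of
-- degree k form a basis both of the degree-k part of the cone ring and of 𝔪ᵏ/𝔪ᵏ⁺¹; counting them
-- gives the Hilbert series and monotonicity.
--
-- Every generating set of I has at least five elements because the quadratic parts of the binomials
-- are independent, while the height is at most 4. The cone ring is not Cohen–Macaulay because
-- x₂ᵐ⁻¹x₄ is nonzero there and killed by every variable, while x₁ is not nilpotent. The curve is
-- Gorenstein at the origin because, modulo the nonzerodivisor x₁, the socle is spanned by that same
-- monomial: it is the unique maximal element of the Apéry set. Elsewhere t = x₄/x₃ is a regular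
-- function, and the local ring inherits a principal maximal ideal from K[t].

universe u

namespace RossiCurve

/-- The exponent vector `(i, j, k, l)`. -/
noncomputable def expVec (i j k l : ℕ) : Fin 4 →₀ ℕ :=
  Finsupp.equivFunOnFinite.symm ![i, j, k, l]

@[simp] theorem expVec_zero (i j k l : ℕ) : expVec i j k l 0 = i := rfl
@[simp] theorem expVec_one (i j k l : ℕ) : expVec i j k l 1 = j := rfl
@[simp] theorem expVec_two (i j k l : ℕ) : expVec i j k l 2 = k := rfl
@[simp] theorem expVec_three (i j k l : ℕ) : expVec i j k l 3 = l := rfl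

theorem expVec_eta (e : Fin 4 →₀ ℕ) : expVec (e 0) (e 1) (e 2) (e 3) = e := by
  ext i; fin_cases i <;> rfl

theorem exp_ext {e f : Fin 4 →₀ ℕ} (h0 : e 0 = f 0) (h1 : e 1 = f 1) (h2 : e 2 = f 2)
    (h3 : e 3 = f 3) : e = f := by
  rw [← expVec_eta e, ← expVec_eta f, h0, h1, h2, h3]

theorem expVec_le {i j k l : ℕ} {e : Fin 4 →₀ ℕ} :
    expVec i j k l ≤ e ↔ i ≤ e 0 ∧ j ≤ e 1 ∧ k ≤ e 2 ∧ l ≤ e 3 := by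
  rw [Finsupp.le_def, Fin.forall_fin_succ, Fin.forall_fin_succ, Fin.forall_fin_succ,
    Fin.forall_fin_succ]
  simp only [IsEmpty.forall_iff, and_true]
  rfl

theorem degree_eq (e : Fin 4 →₀ ℕ) : e.degree = e 0 + e 1 + e 2 + e 3 := by
  rw [Finsupp.degree_eq_sum, Fin.sum_univ_four]

/-- The weight of a monomial: its image under the parametrization is `t` to this power. -/
def weight (m : ℕ) (e : Fin 4 →₀ ℕ) : ℕ :=
  e 0 * (2 * m + 1) + e 1 * (2 * m + 3) + e 2 * (2 * m ^ 2 + m - 2) + e 3 * (2 * m ^ 2 + m - 1)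

theorem weight_add (m : ℕ) (e f : Fin 4 →₀ ℕ) : weight m (e + f) = weight m e + weight m f := by
  simp only [weight, Finsupp.add_apply]; ring

theorem weight_cast {m : ℕ} (hm : 4 ≤ m) (e : Fin 4 →₀ ℕ) :
    (weight m e : ℤ) = e 0 * (2 * m + 1) + e 1 * (2 * m + 3) + e 2 * (2 * m ^ 2 + m - 2)
      + e 3 * (2 * m ^ 2 + m - 1) := by
  have h1 : 2 ≤ 2 * m ^ 2 + m := by nlinarith
  have h2 : 1 ≤ 2 * m ^ 2 + m := by nlinarith
  simp only [weight]
  push_cast [Nat.cast_sub h1, Nat.cast_sub h2]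
  ring

/-- Every exponent of the curve is positive. This bound makes rewriting that raises the degree at
fixed weight terminate. -/
theorem degree_le_weight {m : ℕ} (hm : 4 ≤ m) (e : Fin 4 →₀ ℕ) : e.degree ≤ weight m e := by
  have h0 : 4 ≤ m ^ 2 := by nlinarith
  have h1 : 1 ≤ 2 * m ^ 2 + m - 2 := by omega
  have h2 : 1 ≤ 2 * m ^ 2 + m - 1 := by omega
  rw [degree_eq, weight]
  have a0 := Nat.le_mul_of_pos_right (e 0) (show 0 < 2 * m + 1 by omega)
  have a1 := Nat.le_mul_of_pos_right (e 1) (show 0 < 2 * m + 3 by omega)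
  have a2 := Nat.le_mul_of_pos_right (e 2) h1
  have a3 := Nat.le_mul_of_pos_right (e 3) h2
  omega

/-! ### Standard monomials and uniqueness by weight -/

/-- The standard monomials: those outside the initial ideal of the tangent cone. -/
def Standard (m : ℕ) (e : Fin 4 →₀ ℕ) : Prop :=
  (e 1 ≤ 2 * m ∧ e 2 = 0 ∧ e 3 = 0) ∨ (e 0 ≤ m + 1 ∧ e 1 = 0 ∧ e 2 = 1 ∧ e 3 = 0) ∨
    (e 0 = 0 ∧ e 1 < m ∧ e 2 = 0 ∧ e 3 = 1)

/-- An integer of absolute value less than one of its divisors vanishes. -/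
theorem eq_zero_of_dvd_of_abs {n x : ℤ} (h : n ∣ x) (h1 : -n < x) (h2 : x < n) : x = 0 :=
  Int.eq_zero_of_abs_lt_dvd h (abs_lt.2 ⟨h1, h2⟩)

theorem dvd_of_dvd_two_mul {m : ℕ} {x : ℤ} (h : (2 * m + 1 : ℤ) ∣ 2 * x) : (2 * m + 1 : ℤ) ∣ x := by
  refine IsCoprime.dvd_of_dvd_mul_left ?_ h
  exact ⟨1, -m, by ring⟩

/-- Standard monomials are determined by their weight. -/
theorem Standard.ext {m : ℕ} (hm : 4 ≤ m) {e f : Fin 4 →₀ ℕ} (he : Standard m e)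
    (hf : Standard m f) (h : weight m e = weight m f) : e = f := by
  have hz : (weight m e : ℤ) = weight m f := by rw [h]
  rw [weight_cast hm, weight_cast hm] at hz
  have hm' : (4 : ℤ) ≤ m := by exact_mod_cast hm
  -- Since 2m²+m = m(2m+1), the four exponents are 0, 2, -2, -1 modulo 2m+1. As 2 is invertible, the
  -- residue determines the x₂-exponent within its allowed range.
  have key1 : ∀ {i j i' j' : ℕ}, j ≤ 2 * m → j' ≤ 2 * m →
      (i * (2 * m + 1) + j * (2 * m + 3) : ℤ) = i' * (2 * m + 1) + j' * (2 * m + 3) →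
      i = i' ∧ j = j' := by
    intro i j i' j' hj hj' h
    have : (2 * m + 1 : ℤ) ∣ (j - j' : ℤ) :=
      dvd_of_dvd_two_mul ⟨i' + j' - i - j, by linear_combination h⟩
    have hjj := eq_zero_of_dvd_of_abs this (by omega) (by omega)
    have hj : j = j' := by omega
    subst hj
    have : (2 * m + 1 : ℤ) * (i - i') = 0 := by linear_combination h
    rcases mul_eq_zero.1 this with h | h <;> omega
  -- The residue forces j = 2m, and then the left side is at least 4m²+6m, while i' ≤ m+1 keeps the
  -- right side at most 4m²+4m-1.
  have key2 : ∀ {i j i' : ℕ}, j ≤ 2 * m → i' ≤ m + 1 →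
      (i * (2 * m + 1) + j * (2 * m + 3) : ℤ) ≠ i' * (2 * m + 1) + (2 * m ^ 2 + m - 2) := by
    intro i j i' hj hi' h
    have : (2 * m + 1 : ℤ) ∣ (j - 2 * m : ℤ) :=
      dvd_of_dvd_two_mul ⟨i' + m - 2 - i - j, by linear_combination h⟩
    have hjj := eq_zero_of_dvd_of_abs this (by omega) (by omega)
    have hj : (j : ℤ) = 2 * m := by omega
    rw [hj] at h
    have hi'' : (i' : ℤ) ≤ m + 1 := by exact_mod_cast hi'
    have hi : (0 : ℤ) ≤ i := by positivity
    nlinarith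
  -- The residue forces j = j'+m, and m(2m+3) already exceeds 2m²+m-1.
  have key3 : ∀ {i j j' : ℕ}, j ≤ 2 * m → j' < m →
      (i * (2 * m + 1) + j * (2 * m + 3) : ℤ) ≠ j' * (2 * m + 3) + (2 * m ^ 2 + m - 1) := by
    intro i j j' hj hj' h
    have : (2 * m + 1 : ℤ) ∣ (j - j' - m : ℤ) :=
      dvd_of_dvd_two_mul ⟨j' + m - 1 - i - j, by linear_combination h⟩
    have hjj := eq_zero_of_dvd_of_abs this (by omega) (by omega)
    have hj : (j : ℤ) = j' + m := by omega
    rw [hj] at h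
    have hi : (0 : ℤ) ≤ i := by positivity
    nlinarith
  have key4 : ∀ {i j' : ℕ}, j' < m →
      (i * (2 * m + 1) + (2 * m ^ 2 + m - 2) : ℤ) ≠ j' * (2 * m + 3) + (2 * m ^ 2 + m - 1) := by
    intro i j' hj' h
    have : (2 * m + 1 : ℤ) ∣ (j' - m : ℤ) :=
      dvd_of_dvd_two_mul ⟨i - j' - 1, by linear_combination -h⟩
    have hjj := eq_zero_of_dvd_of_abs this (by omega) (by omega)
    omega
  have n1 : (2 * m + 1 : ℤ) ≠ 0 := by omega
  have n3 : (2 * m + 3 : ℤ) ≠ 0 := by omega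
  rcases he with ⟨a1, a2, a3⟩ | ⟨a0, a1, a2, a3⟩ | ⟨a0, a1, a2, a3⟩ <;>
  rcases hf with ⟨b1, b2, b3⟩ | ⟨b0, b1, b2, b3⟩ | ⟨b0, b1, b2, b3⟩ <;>
  simp only [a1, a2, a3, b1, b2, b3, Nat.cast_zero, Nat.cast_one, zero_mul, one_mul,
    add_zero] at hz <;>
  (try simp only [a0, Nat.cast_zero, zero_mul, zero_add] at hz) <;>
  (try simp only [b0, Nat.cast_zero, zero_mul, zero_add] at hz)
  · obtain ⟨h0, h1⟩ := key1 a1 b1 hz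
    exact exp_ext h0 h1 (by omega) (by omega)
  · exact (key2 a1 b0 hz).elim
  · exact (key3 a1 b1 hz).elim
  · exact (key2 b1 a0 hz.symm).elim
  · have : (e 0 : ℤ) = f 0 := mul_right_cancel₀ n1 (add_right_cancel hz)
    exact exp_ext (by omega) (by omega) (by omega) (by omega)
  · exact (key4 b1 hz).elim
  · exact (key3 b1 a1 hz.symm).elim
  · exact (key4 a1 hz.symm).elim
  · have : (e 1 : ℤ) = f 1 := mul_right_cancel₀ n3 (add_right_cancel hz)
    exact exp_ext (by omega) (by omega) (by omega) (by omega)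

/-! ### Rewriting modulo the five binomials -/

/-- The value of the monomial with exponent `e` at the point `(a, b, c, d)`. -/
def monomialValue {Q : Type*} [CommRing Q] (a b c d : Q) (e : Fin 4 →₀ ℕ) : Q :=
  a ^ e 0 * b ^ e 1 * c ^ e 2 * d ^ e 3

/-- The five binomial equations of the curve. -/
structure Relations {Q : Type*} [CommRing Q] (m : ℕ) (a b c d : Q) : Prop where
  bc : a ^ (m + 1) = b * c
  ad : b ^ m = a * d
  cc : c ^ 2 = b ^ (m - 1) * d
  dd : d ^ 2 = a ^ m * c
  cd : a ^ m * b ^ (m - 1) = c * d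

/-- The leading monomials of the ideal of the tangent cone. -/
def leadingExponents (m : ℕ) : Set (Fin 4 →₀ ℕ) :=
  {expVec 0 1 1 0, expVec 0 0 2 0, expVec 1 0 0 1, expVec 0 0 1 1, expVec 0 0 0 2,
    expVec 0 m 0 1, expVec (m + 2) 0 1 0, expVec 0 (2 * m + 1) 0 0}

theorem exists_leadingExponent_le_iff {m : ℕ} {e : Fin 4 →₀ ℕ} :
    (∃ s ∈ leadingExponents m, s ≤ e) ↔ ¬ Standard m e := by
  simp only [leadingExponents, Set.mem_insert_iff, Set.mem_singleton_iff, exists_eq_or_imp,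
    exists_eq_left, expVec_le, Standard]
  omega

/-- Every leading monomial is congruent to a monomial of the same weight and larger degree. -/
theorem exists_tail {m : ℕ} (hm : 4 ≤ m) {s : Fin 4 →₀ ℕ} (hs : s ∈ leadingExponents m) :
    ∃ s', weight m s' = weight m s ∧ s.degree < s'.degree ∧
      ∀ {Q : Type u} [CommRing Q] {a b c d : Q}, Relations m a b c d →
        monomialValue a b c d s = monomialValue a b c d s' := by
  have w : ∀ e f, (weight m e : ℤ) = weight m f → weight m e = weight m f :=
    fun e f h => by exact_mod_cast h
  have hm1 : ((m - 1 : ℕ) : ℤ) = m - 1 := by omega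
  simp only [leadingExponents, Set.mem_insert_iff, Set.mem_singleton_iff] at hs
  -- The first five cases are the binomials themselves. The other three are consequences: x₂ᵐx₄ =
  -- x₁x₄² = x₁ᵐ⁺¹x₃, x₁ᵐ⁺²x₃ = x₁²x₄² = x₂²ᵐ, and x₂²ᵐ⁺¹ = x₁²x₂x₄² = x₁ᵐ⁺²x₂x₃ = x₁²ᵐ⁺³.
  rcases hs with rfl | rfl | rfl | rfl | rfl | rfl | rfl | rfl
  · refine ⟨expVec (m + 1) 0 0 0, w _ _ ?_, ?_, ?_⟩
    · simp only [weight_cast hm]; simp; ring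
    · simp only [degree_eq]; simp; omega
    · intro Q _ a b c d h
      simp [monomialValue, h.bc]
  · refine ⟨expVec 0 (m - 1) 0 1, w _ _ ?_, ?_, ?_⟩
    · simp only [weight_cast hm]; simp [hm1]; ring
    · simp only [degree_eq]; simp; omega
    · intro Q _ a b c d h
      simp [monomialValue, h.cc]
  · refine ⟨expVec 0 m 0 0, w _ _ ?_, ?_, ?_⟩
    · simp only [weight_cast hm]; simp; ring
    · simp only [degree_eq]; simp; omega
    · intro Q _ a b c d h
      simp [monomialValue, h.ad]
  · refine ⟨expVec m (m - 1) 0 0, w _ _ ?_, ?_, ?_⟩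
    · simp only [weight_cast hm]; simp [hm1]; ring
    · simp only [degree_eq]; simp; omega
    · intro Q _ a b c d h
      simp [monomialValue, h.cd]
  · refine ⟨expVec m 0 1 0, w _ _ ?_, ?_, ?_⟩
    · simp only [weight_cast hm]; simp; ring
    · simp only [degree_eq]; simp; omega
    · intro Q _ a b c d h
      simp [monomialValue, h.dd]
  · refine ⟨expVec (m + 1) 0 1 0, w _ _ ?_, ?_, ?_⟩
    · simp only [weight_cast hm]; simp; ring
    · simp only [degree_eq]; simp
    · intro Q _ a b c d h
      simp only [monomialValue, expVec_zero, expVec_one, expVec_two, expVec_three]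
      linear_combination d * h.ad + a * h.dd
  · refine ⟨expVec 0 (2 * m) 0 0, w _ _ ?_, ?_, ?_⟩
    · simp only [weight_cast hm]; simp; ring
    · simp only [degree_eq]; simp; omega
    · intro Q _ a b c d h
      simp only [monomialValue, expVec_zero, expVec_one, expVec_two, expVec_three]
      rw [two_mul, pow_add b, h.ad]
      linear_combination -a ^ 2 * h.dd
  · refine ⟨expVec (2 * m + 3) 0 0 0, w _ _ ?_, ?_, ?_⟩
    · simp only [weight_cast hm]; simp; ring
    · simp only [degree_eq]; simp
    · intro Q _ a b c d h
      simp only [monomialValue, expVec_zero, expVec_one, expVec_two, expVec_three]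
      rw [pow_succ b, two_mul, pow_add b, h.ad]
      linear_combination a ^ 2 * b * h.dd - a ^ (m + 2) * h.bc

theorem monomialValue_add {Q : Type*} [CommRing Q] (a b c d : Q) (e f : Fin 4 →₀ ℕ) :
    monomialValue a b c d (e + f) = monomialValue a b c d e * monomialValue a b c d f := by
  simp only [monomialValue, Finsupp.add_apply, pow_add]; ring

/-- A nonstandard monomial is congruent to one of the same weight and larger degree. -/
theorem exists_larger_degree {m : ℕ} (hm : 4 ≤ m) {e : Fin 4 →₀ ℕ} (he : ¬ Standard m e) :
    ∃ e', weight m e' = weight m e ∧ e.degree < e'.degree ∧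
      ∀ {Q : Type u} [CommRing Q] {a b c d : Q}, Relations m a b c d →
        monomialValue a b c d e = monomialValue a b c d e' := by
  obtain ⟨s, hs, hse⟩ := exists_leadingExponent_le_iff.2 he
  obtain ⟨r, rfl⟩ := le_iff_exists_add.1 hse
  obtain ⟨s', hw, hd, hv⟩ := exists_tail hm hs
  refine ⟨s' + r, by rw [weight_add, weight_add, hw], by simp only [map_add]; omega, ?_⟩
  intro Q _ a b c d h
  rw [monomialValue_add, monomialValue_add, hv h]

/-- Rewriting fixes the weight and raises the degree, so weight minus degree strictly decreases
until a standard monomial is reached. -/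
theorem exists_standard {m : ℕ} (hm : 4 ≤ m) (e : Fin 4 →₀ ℕ) :
    ∃ e', Standard m e' ∧ weight m e' = weight m e ∧
      ∀ {Q : Type u} [CommRing Q] {a b c d : Q}, Relations m a b c d →
        monomialValue a b c d e = monomialValue a b c d e' := by
  induction hn : weight m e - e.degree using Nat.strong_induction_on generalizing e with
  | _ n ih =>
    by_cases he : Standard m e
    · exact ⟨e, he, rfl, fun _ => rfl⟩
    obtain ⟨e₁, hw, hd, hv⟩ := exists_larger_degree hm he
    have h1 := degree_le_weight hm e₁
    obtain ⟨e₂, h2, h3, h4⟩ := ih (weight m e₁ - e₁.degree) (by omega) e₁ rfl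
    exact ⟨e₂, h2, h3.trans hw, fun h => (hv h).trans (h4 h)⟩

/-- Monomials of equal weight agree wherever the binomial equations hold. -/
theorem monomialValue_eq {m : ℕ} (hm : 4 ≤ m) {e f : Fin 4 →₀ ℕ} (h : weight m e = weight m f)
    {Q : Type*} [CommRing Q] {a b c d : Q} (hQ : Relations m a b c d) :
    monomialValue a b c d e = monomialValue a b c d f := by
  obtain ⟨e', h1, h2, h3⟩ := exists_standard hm e
  obtain ⟨f', h4, h5, h6⟩ := exists_standard hm f
  rw [h3 hQ, h6 hQ, h1.ext hm h4 (by omega)]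

/-- A standard monomial has the largest degree among all monomials of its weight. -/
theorem Standard.degree_le {m : ℕ} (hm : 4 ≤ m) {u e : Fin 4 →₀ ℕ} (hu : Standard m u)
    (h : weight m e = weight m u) : e.degree ≤ u.degree ∧ (e.degree = u.degree → e = u) := by
  -- The rewriting chain from a nonstandard e must end at u, the only standard monomial of its
  -- weight, and the degree rises at every link.
  have key : ∀ n (e : Fin 4 →₀ ℕ), weight m e - e.degree = n → weight m e = weight m u →
      ¬ Standard m e → e.degree < u.degree := by
    intro n
    induction n using Nat.strong_induction_on with
    | _ n ih =>
      intro e hn hw he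
      obtain ⟨e₁, hw₁, hd, -⟩ := exists_larger_degree.{0} hm he
      have h1 := degree_le_weight hm e₁
      by_cases hs : Standard m e₁
      · rwa [hs.ext hm hu (by omega)] at hd
      · have := ih _ (by omega) e₁ rfl (by omega) hs
        omega
  by_cases he : Standard m e
  · rw [he.ext hm hu h]; simp
  · have := key _ e rfl h he
    exact ⟨this.le, fun h => by omega⟩

end RossiCurve

namespace RossiCurve

/-! ### The toric ideal -/

open MvPolynomial

variable {K : Type u} [Field K]

theorem monomial_eq_monomialValue (e : Fin 4 →₀ ℕ) :
    monomial e (1 : K) = monomialValue (X 0) (X 1) (X 2) (X 3) e := by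
  rw [monomial_eq, C_1, one_mul, Finsupp.prod_fintype _ _ (fun i => pow_zero _),
    Fin.prod_univ_four, monomialValue]

theorem monomialValue_map {Q Q' : Type*} [CommRing Q] [CommRing Q'] (g : Q →+* Q') (a b c d : Q)
    (e : Fin 4 →₀ ℕ) :
    g (monomialValue a b c d e) = monomialValue (g a) (g b) (g c) (g d) e := by
  simp [monomialValue]

theorem familyExponents_pos {m : ℕ} (hm : 4 ≤ m) (i : Fin 4) : 0 < familyExponents m i := by
  have : 4 ≤ m ^ 2 := by nlinarith
  fin_cases i <;> simp [familyExponents] <;> omega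

theorem parametrization_monomial (m : ℕ) (e : Fin 4 →₀ ℕ) (r : K) :
    MonomialCurve.parametrization K (familyExponents m) (monomial e r) =
      Polynomial.monomial (weight m e) r := by
  change (aeval _ : MvPolynomial (Fin 4) K →ₐ[K] _) _ = _
  rw [aeval_monomial, Finsupp.prod_fintype _ _ (fun i => pow_zero _), Fin.prod_univ_four]
  simp only [← pow_mul, ← pow_add]
  rw [← Polynomial.C_mul_X_pow_eq_monomial]
  congr 2
  simp only [weight, familyExponents]
  simp
  ring

theorem coeff_parametrization (m : ℕ) (f : MvPolynomial (Fin 4) K) (s : ℕ) :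
    (MonomialCurve.parametrization K (familyExponents m) f).coeff s =
      ∑ e ∈ f.support with weight m e = s, coeff e f := by
  conv_lhs => rw [f.as_sum]
  rw [map_sum, Polynomial.finsetSum_coeff, Finset.sum_filter]
  refine Finset.sum_congr rfl fun e _ => ?_
  rw [parametrization_monomial, Polynomial.coeff_monomial]

/-- The five binomials generating the toric ideal. -/
def binomials (K : Type*) [Field K] (m : ℕ) : Set (MvPolynomial (Fin 4) K) :=
  {X 0 ^ (m + 1) - X 1 * X 2, X 1 ^ m - X 0 * X 3, X 2 ^ 2 - X 1 ^ (m - 1) * X 3,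
    X 3 ^ 2 - X 0 ^ m * X 2, X 0 ^ m * X 1 ^ (m - 1) - X 2 * X 3}

theorem relations_quotient {m : ℕ} {I : Ideal (MvPolynomial (Fin 4) K)}
    (h : binomials K m ⊆ I) :
    Relations m (Ideal.Quotient.mk I (X 0)) (Ideal.Quotient.mk I (X 1))
      (Ideal.Quotient.mk I (X 2)) (Ideal.Quotient.mk I (X 3)) := by
  simp only [binomials, Set.insert_subset_iff, Set.singleton_subset_iff, SetLike.mem_coe] at h
  obtain ⟨h1, h2, h3, h4, h5⟩ := h
  constructor <;> simp only [← map_pow, ← map_mul] <;> rw [Ideal.Quotient.eq] <;> assumption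

theorem relations_parametrization {m : ℕ} (hm : 4 ≤ m) :
    Relations m (Polynomial.X ^ (2 * m + 1) : Polynomial K) (Polynomial.X ^ (2 * m + 3))
      (Polynomial.X ^ (2 * m ^ 2 + m - 2)) (Polynomial.X ^ (2 * m ^ 2 + m - 1)) := by
  obtain ⟨n, rfl⟩ : ∃ n, m = n + 1 := ⟨m - 1, by omega⟩
  have h2 : 2 * (n + 1) ^ 2 + (n + 1) - 2 = 2 * n ^ 2 + 5 * n + 1 := by
    rw [show 2 * (n + 1) ^ 2 + (n + 1) = 2 * n ^ 2 + 5 * n + 3 by ring]; omega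
  have h1 : 2 * (n + 1) ^ 2 + (n + 1) - 1 = 2 * n ^ 2 + 5 * n + 2 := by
    rw [show 2 * (n + 1) ^ 2 + (n + 1) = 2 * n ^ 2 + 5 * n + 3 by ring]; omega
  rw [h1, h2]
  constructor <;> simp only [Nat.add_sub_cancel, ← pow_mul, ← pow_add] <;> congr 1 <;> ring

theorem binomials_subset_toricIdeal {m : ℕ} (hm : 4 ≤ m) :
    binomials K m ⊆ MonomialCurve.toricIdeal K (familyExponents m) := by
  have h := relations_parametrization (K := K) hm
  have hX : ∀ i, MonomialCurve.parametrization K (familyExponents m) (X i) =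
      Polynomial.X ^ familyExponents m i := fun i => aeval_X _ i
  intro g hg
  rw [SetLike.mem_coe, MonomialCurve.toricIdeal, RingHom.mem_ker]
  rcases hg with rfl | rfl | rfl | rfl | rfl <;>
    simp only [map_sub, map_mul, map_pow, hX, sub_eq_zero]
  exacts [h.bc, h.ad, h.cc, h.dd, h.cd]

/-- The binomial relations hold in the quotient by I, where monomials of equal weight share a
standard form. Leaving I general serves both the span of the binomials and the toric ideal. -/
theorem monomial_sub_mem {m : ℕ} (hm : 4 ≤ m) {I : Ideal (MvPolynomial (Fin 4) K)}
    (h : binomials K m ⊆ I) {e f : Fin 4 →₀ ℕ} (hef : weight m e = weight m f) :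
    monomial e (1 : K) - monomial f 1 ∈ I := by
  rw [← Ideal.Quotient.eq, monomial_eq_monomialValue, monomial_eq_monomialValue,
    monomialValue_map, monomialValue_map]
  exact monomialValue_eq hm hef (relations_quotient h)

/-- The toric ideal is generated by the five binomials. -/
theorem span_binomials {m : ℕ} (hm : 4 ≤ m) :
    Ideal.span (binomials K m) = MonomialCurve.toricIdeal K (familyExponents m) := by
  classical
  refine le_antisymm (Ideal.span_le.2 (binomials_subset_toricIdeal hm)) fun f hf => ?_
  -- With one monomial chosen for each weight, `L` lifts K[t] back linearly. Each g is congruent to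
  -- the lift of its image modulo the binomials, and for f in the kernel this lift is 0.
  let ρ : ℕ → (Fin 4 →₀ ℕ) := Function.invFun (weight m)
  have hρ : ∀ e, weight m (ρ (weight m e)) = weight m e := fun e => Function.invFun_eq ⟨e, rfl⟩
  let L : Polynomial K →ₗ[K] MvPolynomial (Fin 4) K :=
    Polynomial.lsum fun s => (monomial (ρ s) : K →ₗ[K] MvPolynomial (Fin 4) K)
  have key : ∀ g : MvPolynomial (Fin 4) K,
      g - L (MonomialCurve.parametrization K (familyExponents m) g) ∈
        Ideal.span (binomials K m) := by
    intro g
    induction g using MvPolynomial.induction_on' with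
    | monomial e r =>
      have hL : L (Polynomial.monomial (weight m e) r) = monomial (ρ (weight m e)) r := by
        simp [L, Polynomial.lsum_apply, Polynomial.sum_monomial_index]
      rw [parametrization_monomial, hL]
      have := Ideal.mul_mem_left _ (C r) (monomial_sub_mem (K := K) hm
        (Ideal.subset_span (s := binomials K m)) (hρ e).symm)
      simpa [mul_sub, C_mul_monomial] using this
    | add p q hp hq =>
      have := Ideal.add_mem _ hp hq
      rw [map_add, map_add]
      convert this using 1
      ring
  have := key f
  rw [MonomialCurve.toricIdeal, RingHom.mem_ker] at hf
  rwa [hf, map_zero, sub_zero] at this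

/-- If `f` lies in the toric ideal and all its monomials have at least the degree of the
standard monomial `u`, then `u` does not occur in `f`. -/
theorem coeff_standard_eq_zero {m : ℕ} (hm : 4 ≤ m) {f : MvPolynomial (Fin 4) K}
    (hf : f ∈ MonomialCurve.toricIdeal K (familyExponents m)) {u : Fin 4 →₀ ℕ}
    (hu : Standard m u) (hdeg : ∀ e ∈ f.support, u.degree ≤ e.degree) : coeff u f = 0 := by
  have h : (MonomialCurve.parametrization K (familyExponents m) f).coeff (weight m u) = 0 := by
    rw [(RingHom.mem_ker.1 hf), Polynomial.coeff_zero]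
  rw [coeff_parametrization, Finset.sum_eq_single u] at h
  · exact h
  · intro e he hne
    obtain ⟨he, hw⟩ := Finset.mem_filter.1 he
    obtain ⟨h1, h2⟩ := hu.degree_le hm hw
    exact (hne (h2 (le_antisymm h1 (hdeg e he)))).elim
  · intro hu'
    rw [Finset.mem_filter] at hu'
    simpa using hu'

/-! ### The tangent cone -/

theorem coeff_initialForm {d : ℕ} (f : MvPolynomial (Fin d) K) (e : Fin d →₀ ℕ) :
    coeff e (initialForm f) =
      if e.degree = sInf {k : ℕ | homogeneousComponent k f ≠ 0} then coeff e f else 0 :=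
  coeff_homogeneousComponent _ _ _

theorem sInf_le_degree {d : ℕ} {f : MvPolynomial (Fin d) K} {e : Fin d →₀ ℕ}
    (he : e ∈ f.support) : sInf {k : ℕ | homogeneousComponent k f ≠ 0} ≤ e.degree := by
  refine Nat.sInf_le fun h => ?_
  have : coeff e (homogeneousComponent e.degree f) = 0 := by rw [h, coeff_zero]
  rw [coeff_homogeneousComponent, if_pos rfl] at this
  exact mem_support_iff.1 he this

theorem initialForm_monomial_sub {d : ℕ} {s s' : Fin d →₀ ℕ} (h : s.degree < s'.degree) :
    initialForm (monomial s (1 : K) - monomial s' 1) = monomial s 1 := by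
  classical
  have hne : s ≠ s' := fun h' => by rw [h'] at h; exact lt_irrefl _ h
  have hInf : sInf {k : ℕ | homogeneousComponent k (monomial s (1 : K) - monomial s' 1) ≠ 0} =
      s.degree := by
    refine le_antisymm (sInf_le_degree ?_) (le_csInf ⟨s.degree, fun h0 => ?_⟩ fun k hk => ?_)
    · simp [coeff_monomial, hne.symm]
    · have : coeff s (homogeneousComponent s.degree (monomial s (1 : K) - monomial s' 1)) = 0 := by
        rw [h0, coeff_zero]
      simp [coeff_homogeneousComponent, coeff_monomial, hne.symm] at this
    · by_contra! hlt
      refine hk ?_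
      ext e
      rw [coeff_homogeneousComponent]
      split_ifs with he
      · have h1 : s ≠ e := by rintro rfl; omega
        have h2 : s' ≠ e := by rintro rfl; omega
        simp [coeff_monomial, h1, h2]
      · simp
  ext e
  rw [coeff_initialForm, hInf]
  simp only [coeff_sub, coeff_monomial]
  by_cases h1 : s = e
  · subst h1; simp [hne.symm]
  · by_cases h2 : s' = e
    · subst h2; simp [h1, h.ne']
    · simp [h1, h2]

/-- The monomial ideal of the tangent cone. -/
noncomputable def coneIdeal (K : Type*) [Field K] (m : ℕ) : Ideal (MvPolynomial (Fin 4) K) :=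
  Ideal.span ((fun s => monomial s (1 : K)) '' leadingExponents m)

theorem mem_coneIdeal {m : ℕ} {f : MvPolynomial (Fin 4) K} :
    f ∈ coneIdeal K m ↔ ∀ e ∈ f.support, ¬ Standard m e := by
  simp only [coneIdeal, mem_ideal_span_monomial_image, exists_leadingExponent_le_iff]

theorem coneIdeal_eq (m : ℕ) : coneIdeal K m =
    Ideal.span {X 1 * X 2, X 2 ^ 2, X 0 * X 3, X 2 * X 3, X 3 ^ 2, X 1 ^ m * X 3,
        X 0 ^ (m + 2) * X 2, X 1 ^ (2 * m + 1)} := by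
  simp [coneIdeal, leadingExponents, Set.image_insert_eq, monomial_eq_monomialValue,
    monomialValue]

/-- No standard monomial survives in an initial form, as it would be of least degree in f yet of
largest degree in its weight class. Conversely, each leading monomial is the initial form of its
difference with its tail. -/
theorem initialFormIdeal_toricIdeal {m : ℕ} (hm : 4 ≤ m) :
    initialFormIdeal (MonomialCurve.toricIdeal K (familyExponents m)) = coneIdeal K m := by
  refine le_antisymm (Ideal.span_le.2 ?_) (Ideal.span_le.2 ?_)
  · rintro _ ⟨f, hf, rfl⟩
    refine mem_coneIdeal.2 fun e he hs => ?_
    rw [mem_support_iff, coeff_initialForm] at he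
    split_ifs at he with hdeg
    · exact he (coeff_standard_eq_zero hm hf hs fun e' he' => hdeg ▸ sInf_le_degree he')
    · exact he rfl
  · rintro _ ⟨s, hs, rfl⟩
    obtain ⟨s', hw, hd, -⟩ := exists_tail.{0} hm hs
    exact Ideal.subset_span ⟨_, monomial_sub_mem hm (binomials_subset_toricIdeal hm) hw.symm,
      initialForm_monomial_sub hd⟩

end RossiCurve

namespace RossiCurve

/-! ### Minimality of the generators -/

open MvPolynomial

variable {K : Type u} [Field K]

/-- The quadratic monomials that distinguish the five binomials. -/
noncomputable def quadraticExponent : Fin 5 → (Fin 4 →₀ ℕ) :=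
  ![expVec 0 1 1 0, expVec 1 0 0 1, expVec 0 0 2 0, expVec 0 0 0 2, expVec 0 0 1 1]

theorem degree_quadraticExponent (i : Fin 5) : (quadraticExponent i).degree = 2 := by
  rw [degree_eq]
  fin_cases i <;> rfl

/-- The coefficients at the five distinguished quadratic monomials. -/
noncomputable def quadraticPart : MvPolynomial (Fin 4) K →ₗ[K] (Fin 5 → K) :=
  LinearMap.pi fun i => lcoeff K (quadraticExponent i)

theorem quadraticPart_apply (f : MvPolynomial (Fin 4) K) (i : Fin 5) :
    quadraticPart f i = coeff (quadraticExponent i) f := rfl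

/-- In the lowest degree a multiplier acts only through its constant term. -/
theorem coeff_mul_of_mem_pow {σ : Type*} {n : ℕ} {f : MvPolynomial σ K}
    (hf : f ∈ idealOfVars σ K ^ n) (h : MvPolynomial σ K) {e : σ →₀ ℕ} (he : e.degree = n) :
    coeff e (h * f) = coeff 0 h * coeff e f := by
  classical
  rw [coeff_mul, Finset.sum_eq_single (0, e)]
  · rintro ⟨x, y⟩ hxy hne
    rw [Finset.HasAntidiagonal.mem_antidiagonal] at hxy
    have hdeg : x.degree + y.degree = e.degree := by rw [← hxy, map_add]
    rcases Nat.lt_or_ge y.degree n with hlt | hge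
    · rw [(mem_pow_idealOfVars_iff' n f).1 hf y hlt, mul_zero]
    · have hx : x = 0 := (Finsupp.degree_eq_zero_iff x).1 (by omega)
      subst hx
      rw [zero_add] at hxy
      exact (hne (by rw [← hxy])).elim
  · intro h0
    simp at h0

/-- On the square of the ideal of the variables, `quadraticPart` turns polynomial multipliers into
scalars, so counting generators becomes linear algebra in K⁵. -/
theorem quadraticPart_mem_span {T : Set (MvPolynomial (Fin 4) K)}
    (hT : T ⊆ (idealOfVars (Fin 4) K ^ 2 : Ideal _)) {f : MvPolynomial (Fin 4) K}
    (hf : f ∈ Ideal.span T) : quadraticPart f ∈ Submodule.span K (quadraticPart '' T) := by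
  have : f ∈ idealOfVars (Fin 4) K ^ 2 ∧
      quadraticPart f ∈ Submodule.span K (quadraticPart '' T) := by
    induction hf using Submodule.span_induction with
    | mem x hx => exact ⟨hT hx, Submodule.subset_span ⟨x, hx, rfl⟩⟩
    | zero => exact ⟨zero_mem _, by rw [map_zero]; exact zero_mem _⟩
    | add x y _ _ hx hy =>
      exact ⟨add_mem hx.1 hy.1, by rw [map_add]; exact add_mem hx.2 hy.2⟩
    | smul a x _ hx =>
      refine ⟨Ideal.mul_mem_left _ _ hx.1, ?_⟩
      have : quadraticPart (a • x) = coeff 0 a • quadraticPart x := by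
        ext i
        rw [quadraticPart_apply, smul_eq_mul,
          coeff_mul_of_mem_pow hx.1 a (degree_quadraticExponent i)]
        rfl
      rw [this]
      exact Submodule.smul_mem _ _ hx.2
  exact this.2

/-- The five binomials as a family. -/
noncomputable def binomial (K : Type*) [Field K] (m : ℕ) : Fin 5 → MvPolynomial (Fin 4) K :=
  ![X 0 ^ (m + 1) - X 1 * X 2, X 1 ^ m - X 0 * X 3, X 2 ^ 2 - X 1 ^ (m - 1) * X 3,
    X 3 ^ 2 - X 0 ^ m * X 2, X 0 ^ m * X 1 ^ (m - 1) - X 2 * X 3]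

theorem range_binomial (m : ℕ) : Set.range (binomial K m) = binomials K m := by
  simp only [binomial, Matrix.range_cons, Matrix.range_empty, Set.union_empty, binomials,
    Set.singleton_union]

/-- The exponents of the two terms of each binomial. -/
noncomputable def binomialExponents (m : ℕ) : Fin 5 → (Fin 4 →₀ ℕ) × (Fin 4 →₀ ℕ) :=
  ![(expVec (m + 1) 0 0 0, expVec 0 1 1 0), (expVec 0 m 0 0, expVec 1 0 0 1),
    (expVec 0 0 2 0, expVec 0 (m - 1) 0 1), (expVec 0 0 0 2, expVec m 0 1 0),
    (expVec m (m - 1) 0 0, expVec 0 0 1 1)]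

theorem binomial_eq (m : ℕ) (i : Fin 5) :
    binomial K m i = monomial (binomialExponents m i).1 1 - monomial (binomialExponents m i).2 1 := by
  fin_cases i <;> simp [binomial, binomialExponents, monomial_eq_monomialValue, monomialValue]

theorem binomial_mem_sq {m : ℕ} (hm : 4 ≤ m) (i : Fin 5) :
    binomial K m i ∈ idealOfVars (Fin 4) K ^ 2 := by
  rw [binomial_eq]
  refine sub_mem ((monomial_mem_pow_idealOfVars_iff 2 _ one_ne_zero).2 ?_)
    ((monomial_mem_pow_idealOfVars_iff 2 _ one_ne_zero).2 ?_) <;> rw [degree_eq] <;>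
  fin_cases i <;> simp [binomialExponents] <;> omega

theorem expVec_inj {i j k l i' j' k' l' : ℕ} :
    expVec i j k l = expVec i' j' k' l' ↔ i = i' ∧ j = j' ∧ k = k' ∧ l = l' := by
  constructor
  · intro h
    exact ⟨congrArg (· 0) h, congrArg (· 1) h, congrArg (· 2) h, congrArg (· 3) h⟩
  · rintro ⟨rfl, rfl, rfl, rfl⟩
    rfl

/-- Each binomial has exactly one quadratic term; for m ≥ 4 its other term has degree at least 3. -/
theorem quadraticPart_binomial {m : ℕ} (hm : 4 ≤ m) (i : Fin 5) :
    quadraticPart (binomial K m i) = Pi.single i (![-1, -1, 1, 1, -1] i) := by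
  classical
  have h1 : m ≠ 0 := by omega
  have h2 : m ≠ 1 := by omega
  have h3 : m - 1 ≠ 0 := by omega
  have h4 : m - 1 ≠ 1 := by omega
  ext j
  rw [quadraticPart_apply, binomial_eq]
  fin_cases i <;> fin_cases j <;>
    simp [binomialExponents, quadraticExponent, coeff_monomial, expVec_inj,
      h1, h2, h3, h4]

theorem sign_ne_zero (i : Fin 5) : (![-1, -1, 1, 1, -1] : Fin 5 → K) i ≠ 0 := by
  fin_cases i <;> simp

/-- If binomial i is left out, coordinate i of the quadratic part vanishes on everything the
remaining ones generate, but not on binomial i. -/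
theorem isMinimalGeneratingSet_binomials {m : ℕ} (hm : 4 ≤ m) :
    IsMinimalGeneratingSet (MonomialCurve.toricIdeal K (familyExponents m)) (binomials K m) := by
  refine ⟨span_binomials hm, fun T hT h => ?_⟩
  obtain ⟨hsub, x, hx, hxT⟩ := Set.ssubset_iff_exists.1 hT
  rw [← range_binomial] at hx hsub
  obtain ⟨i, rfl⟩ := hx
  have hsq : T ⊆ (idealOfVars (Fin 4) K ^ 2 : Ideal _) := by
    intro t ht
    obtain ⟨j, rfl⟩ := hsub ht
    exact binomial_mem_sq hm j
  have hmem : binomial K m i ∈ Ideal.span T := by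
    rw [h]
    exact binomials_subset_toricIdeal hm (range_binomial (K := K) m ▸ ⟨i, rfl⟩)
  have hle : Submodule.span K (quadraticPart '' T) ≤
      LinearMap.ker (LinearMap.proj i : (Fin 5 → K) →ₗ[K] K) := by
    rw [Submodule.span_le]
    rintro _ ⟨t, ht, rfl⟩
    obtain ⟨j, rfl⟩ := hsub ht
    have hji : i ≠ j := by rintro rfl; exact hxT ht
    simp [quadraticPart_binomial hm, hji]
  have := hle (quadraticPart_mem_span hsq hmem)
  rw [LinearMap.mem_ker, LinearMap.proj_apply, quadraticPart_binomial hm, Pi.single_eq_same] at this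
  exact sign_ne_zero i this

theorem toricIdeal_le_sq {m : ℕ} (hm : 4 ≤ m) :
    MonomialCurve.toricIdeal K (familyExponents m) ≤ idealOfVars (Fin 4) K ^ 2 := by
  rw [← span_binomials hm, Ideal.span_le, ← range_binomial]
  rintro _ ⟨j, rfl⟩
  exact binomial_mem_sq hm j

theorem span_quadraticPart {m : ℕ} (hm : 4 ≤ m) {T : Set (MvPolynomial (Fin 4) K)}
    (h : Ideal.span T = MonomialCurve.toricIdeal K (familyExponents m)) :
    Submodule.span K (quadraticPart '' T) = ⊤ := by
  have hsq : T ⊆ (idealOfVars (Fin 4) K ^ 2 : Ideal _) := fun t ht =>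
    toricIdeal_le_sq hm (h ▸ Ideal.subset_span ht)
  rw [eq_top_iff, ← (Pi.basisFun K (Fin 5)).span_eq, Submodule.span_le]
  rintro _ ⟨i, rfl⟩
  have hmem : binomial K m i ∈ Ideal.span T := by
    rw [h]
    exact binomials_subset_toricIdeal hm (range_binomial (K := K) m ▸ ⟨i, rfl⟩)
  have h1 := Submodule.smul_mem _ ((![-1, -1, 1, 1, -1] : Fin 5 → K) i)⁻¹
    (quadraticPart_mem_span hsq hmem)
  rw [quadraticPart_binomial hm, ← Pi.single_smul, smul_eq_mul,
    inv_mul_cancel₀ (sign_ne_zero i)] at h1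
  simpa using h1

theorem idealOfVars_ne_top : idealOfVars (Fin 4) K ≠ ⊤ := by
  intro h
  have h1 : (1 : MvPolynomial (Fin 4) K) ∈ idealOfVars (Fin 4) K ^ 1 := by rw [pow_one, h]; trivial
  have := (mem_pow_idealOfVars_iff' 1 (1 : MvPolynomial (Fin 4) K)).1 h1 0 (by simp)
  simp at this

/-- The curve is not a complete intersection. -/
theorem not_isCompleteIntersectionIdeal {m : ℕ} (hm : 4 ≤ m) :
    ¬ IsCompleteIntersectionIdeal (MonomialCurve.toricIdeal K (familyExponents m)) := by
  classical
  rintro ⟨s, hs, hcard⟩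
  have h5 : 5 ≤ s.card := by
    have h1 := finrank_span_finset_le_card (R := K) (s.image (quadraticPart (K := K)))
    rw [Set.finrank, Finset.coe_image, span_quadraticPart hm hs, finrank_top,
      Module.finrank_fin_fun] at h1
    exact h1.trans Finset.card_image_le
  -- Four variables generate an ideal above I, so Krull's height theorem bounds the height by 4.
  -- This crude bound suffices against five generators.
  have h4 : (MonomialCurve.toricIdeal K (familyExponents m)).height ≤ 4 := by
    refine (Ideal.height_mono ((toricIdeal_le_sq hm).trans (Ideal.pow_le_self two_ne_zero))).trans
      ((Ideal.height_le_spanFinrank _ idealOfVars_ne_top).trans ?_)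
    have := Submodule.spanFinrank_span_le_ncard_of_finite (R := MvPolynomial (Fin 4) K)
      (Set.finite_range (X : Fin 4 → MvPolynomial (Fin 4) K))
    have h2 : (Set.range (X : Fin 4 → MvPolynomial (Fin 4) K)).ncard ≤ 4 := by
      rw [← Set.image_univ]
      refine (Set.ncard_image_le).trans ?_
      simp [Set.ncard_univ]
    exact_mod_cast this.trans h2
  have h6 : (5 : ℕ∞) ≤ 4 := (by exact_mod_cast h5 : (5 : ℕ∞) ≤ s.card).trans (hcard.trans h4)
  exact absurd h6 (by decide)

/-! ### The Hilbert function of the tangent cone -/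

/-- The standard exponents of degree `k`. -/
noncomputable def standardOfDegree (m k : ℕ) : Finset (Fin 4 →₀ ℕ) :=
  (Finset.range (min k (2 * m) + 1)).image (fun j => expVec (k - j) j 0 0) ∪
    ((if 1 ≤ k ∧ k ≤ m + 2 then {expVec (k - 1) 0 1 0} else ∅) ∪
      (if 1 ≤ k ∧ k ≤ m then {expVec 0 (k - 1) 0 1} else ∅))

theorem mem_standardOfDegree {m k : ℕ} {e : Fin 4 →₀ ℕ} :
    e ∈ standardOfDegree m k ↔ Standard m e ∧ e.degree = k := by
  have h2 : e ∈ (if 1 ≤ k ∧ k ≤ m + 2 then {expVec (k - 1) 0 1 0} else ∅ : Finset _) ↔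
      (1 ≤ k ∧ k ≤ m + 2) ∧ e = expVec (k - 1) 0 1 0 := by
    split_ifs with h <;> simp [h]
  have h3 : e ∈ (if 1 ≤ k ∧ k ≤ m then {expVec 0 (k - 1) 0 1} else ∅ : Finset _) ↔
      (1 ≤ k ∧ k ≤ m) ∧ e = expVec 0 (k - 1) 0 1 := by
    split_ifs with h <;> simp [h]
  rw [standardOfDegree, Finset.mem_union, Finset.mem_union, h2, h3, Finset.mem_image, degree_eq,
    ← expVec_eta e]
  simp only [expVec_inj, Finset.mem_range, Standard, expVec_zero, expVec_one, expVec_two,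
    expVec_three]
  constructor
  · rintro (⟨j, hj, h⟩ | h | h) <;> omega
  · rintro ⟨h | h | h, hk⟩
    · exact Or.inl ⟨e 1, by omega, by omega⟩
    · exact Or.inr (Or.inl (by omega))
    · exact Or.inr (Or.inr (by omega))

/-- The number of standard monomials of degree `k`. -/
theorem card_standardOfDegree (m k : ℕ) :
    (standardOfDegree m k).card = min k (2 * m) + 1 + ((if 1 ≤ k ∧ k ≤ m + 2 then 1 else 0) +
      (if 1 ≤ k ∧ k ≤ m then 1 else 0)) := by
  rw [standardOfDegree, Finset.card_union_of_disjoint, Finset.card_union_of_disjoint,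
    Finset.card_image_of_injective, Finset.card_range]
  · split_ifs <;> simp
  · intro i j h
    exact (expVec_inj.1 h).2.1
  · rw [Finset.disjoint_left]
    intro e
    split_ifs <;> simp only [Finset.mem_singleton, Finset.notMem_empty, not_false_eq_true,
      false_imp_iff, imp_true_iff]
    rintro rfl
    rw [expVec_inj]
    omega
  · rw [Finset.disjoint_left]
    simp only [Finset.mem_image, Finset.mem_union]
    rintro _ ⟨j, -, rfl⟩ (h | h) <;> split_ifs at h <;>
      simp only [Finset.mem_singleton, Finset.notMem_empty, expVec_inj] at h <;> omega

/-- The indicator terms drop by one from degree m to m+1 and from m+2 to m+3. Both steps lie below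
2m, where the first term rises by one and compensates; hence the gaps at t^(m+1) and t^(m+3) in the
numerator. -/
theorem monotone_card_standardOfDegree {m : ℕ} (hm : 4 ≤ m) :
    Monotone fun k => (standardOfDegree m k).card := by
  refine monotone_nat_of_le_succ fun k => ?_
  rw [card_standardOfDegree, card_standardOfDegree]
  split_ifs <;> omega

theorem gradedHilbertFunction_coneIdeal (m k : ℕ) :
    gradedHilbertFunction (coneIdeal K m) k = (standardOfDegree m k).card := by
  classical
  let q := (Ideal.Quotient.mkₐ K (coneIdeal K m)).toLinearMap
  have hq : ∀ f, q f = 0 ↔ f ∈ coneIdeal K m := fun f => Ideal.Quotient.eq_zero_iff_mem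
  let v : standardOfDegree m k → MvPolynomial (Fin 4) K ⧸ coneIdeal K m :=
    fun e => q (monomial e.1 1)
  have hv : LinearIndependent K v := by
    rw [Fintype.linearIndependent_iff]
    intro g hg e
    have h1 : ∑ i, g i • v i = q (∑ i, monomial i.1 (g i)) := by
      rw [map_sum]
      refine Finset.sum_congr rfl fun i _ => ?_
      rw [← map_smul, smul_monomial, smul_eq_mul, mul_one]
    rw [h1, hq, mem_coneIdeal] at hg
    have hc : coeff e.1 (∑ i : standardOfDegree m k, monomial i.1 (g i)) = g e := by
      rw [coeff_sum, Finset.sum_eq_single e]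
      · rw [coeff_monomial, if_pos rfl]
      · intro i _ hi
        rw [coeff_monomial, if_neg fun h => hi (Subtype.ext h)]
      · simp
    by_contra hne
    exact hg e.1 (by rwa [mem_support_iff, hc]) (mem_standardOfDegree.1 e.2).1
  have hspan : (homogeneousSubmodule (Fin 4) K k).map q = Submodule.span K (Set.range v) := by
    apply le_antisymm
    · rw [Submodule.map_le_iff_le_comap]
      intro f hf
      rw [Submodule.mem_comap, f.as_sum, map_sum]
      refine Submodule.sum_mem _ fun e he => ?_
      by_cases hs : Standard m e
      · have hd : e.degree = k := by
          have := hf (mem_support_iff.1 he)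
          exact (DFunLike.congr_fun Finsupp.degree_eq_weight_one e).trans this
        have : q (monomial e (coeff e f)) =
            coeff e f • v ⟨e, mem_standardOfDegree.2 ⟨hs, hd⟩⟩ := by
          rw [← map_smul, smul_monomial, smul_eq_mul, mul_one]
        rw [this]
        exact Submodule.smul_mem _ _ (Submodule.subset_span ⟨_, rfl⟩)
      · have : q (monomial e (coeff e f)) = 0 := by
          rw [hq, mem_coneIdeal]
          intro e' he'
          rw [Finset.mem_singleton.1 (support_monomial_subset he')]
          exact hs
        rw [this]
        exact zero_mem _
    · rw [Submodule.span_le]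
      rintro _ ⟨e, rfl⟩
      exact ⟨_, isHomogeneous_monomial _ (mem_standardOfDegree.1 e.2).2, rfl⟩
  change Module.finrank K ((homogeneousSubmodule (Fin 4) K k).map q) = _
  rw [hspan, finrank_span_eq_card hv, Fintype.card_coe]

open Polynomial in
/-- The numerator of the Hilbert series of the tangent cone. -/
theorem exists_hilbertNumerator {m : ℕ} (hm : 4 ≤ m) : ∃ g : Polynomial ℤ,
      g = 1 + 3 * Polynomial.X + ∑ i ∈ Finset.Icc 2 m, Polynomial.X ^ i +
        Polynomial.X ^ (m + 2) + ∑ i ∈ Finset.Icc (m + 4) (2 * m), Polynomial.X ^ i ∧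
      (∀ k, 0 ≤ g.coeff k) ∧
      gradedHilbertSeries (coneIdeal K m) * (1 - PowerSeries.X) = (g : PowerSeries ℤ) := by
  refine ⟨_, rfl, ?_⟩
  have hcoeff : ∀ k, (1 + 3 * Polynomial.X + ∑ i ∈ Finset.Icc 2 m, Polynomial.X ^ i +
        Polynomial.X ^ (m + 2) + ∑ i ∈ Finset.Icc (m + 4) (2 * m), Polynomial.X ^ i :
        Polynomial ℤ).coeff k = (if k = 0 then 1 else 0) + (if k = 1 then 3 else 0) +
        (if 2 ≤ k ∧ k ≤ m then 1 else 0) + (if k = m + 2 then 1 else 0) +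
        (if m + 4 ≤ k ∧ k ≤ 2 * m then 1 else 0) := by
    intro k
    have h3 : (3 * Polynomial.X : Polynomial ℤ).coeff k = if k = 1 then 3 else 0 := by
      rw [show (3 : Polynomial ℤ) = Polynomial.C 3 from rfl, Polynomial.coeff_C_mul_X]
    simp only [Polynomial.coeff_add, Polynomial.finsetSum_coeff, Polynomial.coeff_X_pow, h3,
      Polynomial.coeff_one, Finset.sum_ite_eq, Finset.mem_Icc]
  refine ⟨fun k => ?_, ?_⟩
  · rw [hcoeff]
    split_ifs <;> norm_num
  · ext k
    rw [Polynomial.coeff_coe, hcoeff, mul_sub, mul_one, map_sub]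
    -- Multiplying by 1 - X takes first differences of the count of standard monomials.
    cases k with
    | zero =>
      simp [gradedHilbertSeries, gradedHilbertFunction_coneIdeal, card_standardOfDegree]
    | succ k =>
      rw [PowerSeries.coeff_succ_mul_X]
      simp only [gradedHilbertSeries, PowerSeries.coeff_mk, gradedHilbertFunction_coneIdeal,
        card_standardOfDegree]
      push_cast
      grind

end RossiCurve

namespace RossiCurve

/-! ### The tangent cone is not Cohen-Macaulay -/

open MvPolynomial

variable {K : Type u} [Field K]

theorem standard_zero (m : ℕ) : Standard m 0 := Or.inl ⟨Nat.zero_le _, rfl, rfl⟩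

/-- The product has coefficient g(0) at u. Thus standard monomials stay nonzero after localizing at
the origin. -/
theorem mul_monomial_notMem_coneIdeal {m : ℕ} {u : Fin 4 →₀ ℕ} (hu : Standard m u)
    {g : MvPolynomial (Fin 4) K} (hg : constantCoeff g ≠ 0) :
    g * monomial u 1 ∉ coneIdeal K m := by
  intro h
  refine mem_coneIdeal.1 h u ?_ hu
  have := coeff_mul_monomial 0 u (1 : K) g
  rw [zero_add, mul_one] at this
  rwa [mem_support_iff, this]

/-- The products of x₂ᵐ⁻¹x₄ with the variables are divisible by x₁x₄, x₂ᵐx₄, x₃x₄ and x₄²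
respectively. -/
theorem mul_socle_mem_coneIdeal {m : ℕ} {g : MvPolynomial (Fin 4) K}
    (hg : constantCoeff g = 0) : g * monomial (expVec 0 (m - 1) 0 1) 1 ∈ coneIdeal K m := by
  classical
  refine mem_coneIdeal.2 fun e he hs => ?_
  rw [mem_support_iff, coeff_mul_monomial'] at he
  split_ifs at he with hle
  · obtain ⟨x, rfl⟩ := exists_add_of_le hle
    rw [add_tsub_cancel_left, mul_one] at he
    have hx : x = 0 := by
      simp only [Standard, Finsupp.add_apply, expVec_zero, expVec_one, expVec_two,
        expVec_three] at hs
      refine exp_ext ?_ ?_ ?_ ?_ <;> simp only [Finsupp.coe_zero, Pi.zero_apply] <;> omega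
    rw [hx] at he
    exact he hg
  · exact he rfl

/-- A local ring of positive dimension whose maximal ideal kills a nonzero element is not
Cohen-Macaulay. -/
theorem not_isCohenMacaulayLocalRing {R : Type*} [CommRing R] [IsLocalRing R] {a s : R}
    (ha : a ∈ IsLocalRing.maximalIdeal R) (hpow : ∀ n : ℕ, a ^ n ≠ 0) (hs : s ≠ 0)
    (hsoc : ∀ r ∈ IsLocalRing.maximalIdeal R, r * s = 0) : ¬ IsCohenMacaulayLocalRing R := by
  rintro ⟨-, rs, hrs, hreg, hlen⟩
  -- An empty sequence means dimension 0, which would make a nilpotent; otherwise the first element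
  -- is a nonzerodivisor that kills s.
  cases rs with
  | nil =>
    have hdim : Ring.KrullDimLE 0 R := by
      rw [Ring.krullDimLE_iff, ← hlen]
      simp
    rw [← IsLocalRing.ringJacobson_eq_maximalIdeal,
      Ring.jacobson_eq_nilradical_of_krullDimLE_zero, mem_nilradical] at ha
    obtain ⟨n, hn⟩ := ha
    exact hpow n hn
  | cons r rs =>
    have hreg' := ((RingTheory.Sequence.isRegular_cons_iff _ _ _).1 hreg).1
    refine hs (hreg' ?_)
    change r * s = r * 0
    rw [mul_zero, hsoc r (hrs r (by simp))]

theorem not_isCohenMacaulayRing {m : ℕ} (hm : 4 ≤ m) :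
    ¬ IsCohenMacaulayRing (MvPolynomial (Fin 4) K ⧸ coneIdeal K m) := by
  rintro ⟨-, h⟩
  have hJ : ∀ f ∈ coneIdeal K m, constantCoeff f = 0 := by
    intro f hf
    by_contra hne
    exact mem_coneIdeal.1 hf 0 (mem_support_iff.2 hne) (standard_zero m)
  let ev : MvPolynomial (Fin 4) K ⧸ coneIdeal K m →+* K :=
    Ideal.Quotient.lift (coneIdeal K m) constantCoeff hJ
  have hev : Function.Surjective ev := fun r => ⟨Ideal.Quotient.mk _ (C r), by simp [ev]⟩
  let P : Ideal (MvPolynomial (Fin 4) K ⧸ coneIdeal K m) := RingHom.ker ev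
  have hP : P.IsMaximal := RingHom.ker_isMaximal_of_surjective ev hev
  have hmem : ∀ f, Ideal.Quotient.mk (coneIdeal K m) f ∈ P ↔ constantCoeff f = 0 :=
    fun f => Iff.rfl
  let ψ := algebraMap (MvPolynomial (Fin 4) K ⧸ coneIdeal K m) (Localization.AtPrime P)
  have hne : ∀ u, Standard m u → ψ (Ideal.Quotient.mk _ (monomial u 1)) ≠ 0 := by
    intro u hu h0
    rw [IsLocalization.map_eq_zero_iff P.primeCompl] at h0
    obtain ⟨⟨s, hs⟩, h0⟩ := h0
    obtain ⟨g, rfl⟩ := Ideal.Quotient.mk_surjective s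
    rw [← map_mul, Ideal.Quotient.eq_zero_iff_mem] at h0
    exact mul_monomial_notMem_coneIdeal hu (fun hg => hs ((hmem g).2 hg)) h0
  have hmax : P.map ψ = IsLocalRing.maximalIdeal (Localization.AtPrime P) :=
    Localization.AtPrime.map_eq_maximalIdeal
  have hsoc : Standard m (expVec 0 (m - 1) 0 1) :=
    Or.inr (Or.inr ⟨rfl, by simp; omega, rfl, rfl⟩)
  refine not_isCohenMacaulayLocalRing (R := Localization.AtPrime P)
    (a := ψ (Ideal.Quotient.mk _ (X 0))) ?_ (fun n hn => ?_) (hne _ hsoc) (fun r hr => ?_) (h P)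
  · rw [← hmax]
    exact Ideal.mem_map_of_mem _ ((hmem _).2 (by simp))
  · refine hne (expVec n 0 0 0) (Or.inl ⟨by simp, by simp, by simp⟩) ?_
    rw [monomial_eq_monomialValue]
    simpa [monomialValue] using hn
  · rw [← hmax, IsLocalization.mem_map_algebraMap_iff P.primeCompl] at hr
    obtain ⟨⟨⟨x, hx⟩, s⟩, hxs⟩ := hr
    obtain ⟨g, rfl⟩ := Ideal.Quotient.mk_surjective x
    have hxs' : r * ψ s = ψ (Ideal.Quotient.mk _ g) := hxs
    rw [← (IsLocalization.map_units (Localization.AtPrime P) s).mul_left_eq_zero,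
      mul_right_comm, hxs', ← map_mul, ← map_mul, Ideal.Quotient.eq_zero_iff_mem.2
        (mul_socle_mem_coneIdeal ((hmem g).1 hx)), map_zero]

end RossiCurve

namespace RossiCurve

/-! ### The local ring at the origin -/

open MvPolynomial

variable {K : Type u} [Field K]

open IsLocalRing in
/-- The Hilbert function of a local ring at `k` is the size of a minimal system of generators
of `𝔪ᵏ`. -/
theorem localHilbertFunction_eq_card {R : Type*} [CommRing R] [IsLocalRing R] {k : ℕ} {ι : Type*}
    [Fintype ι] (y : ι → R) (hy : ∀ i, y i ∈ maximalIdeal R ^ k)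
    (hspan : maximalIdeal R ^ k ≤ Ideal.span (Set.range y) ⊔ maximalIdeal R ^ (k + 1))
    (hind : ∀ g : ι → R, ∑ i, g i * y i ∈ maximalIdeal R ^ (k + 1) → ∀ i, g i ∈ maximalIdeal R) :
    localHilbertFunction R k = Fintype.card ι := by
  let N : Submodule R ↥(maximalIdeal R ^ k) := maximalIdeal R • ⊤
  have hN : ∀ x : ↥(maximalIdeal R ^ k), x ∈ N ↔ (x : R) ∈ maximalIdeal R ^ (k + 1) := by
    intro x
    rw [Submodule.mem_smul_top_iff, smul_eq_mul, ← pow_succ']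
  let v : ι → ↥(maximalIdeal R ^ k) ⧸ N := fun i => N.mkQ ⟨y i, hy i⟩
  have hv : LinearIndependent (R ⧸ maximalIdeal R) v := by
    rw [Fintype.linearIndependent_iff]
    intro g hg i
    choose r hr using fun i => Ideal.Quotient.mk_surjective (g i)
    have h1 : ∑ i, g i • v i = N.mkQ (∑ i, r i • ⟨y i, hy i⟩) := by
      rw [map_sum]
      refine Finset.sum_congr rfl fun j _ => ?_
      rw [map_smul, ← hr j]
      rfl
    rw [h1, Submodule.mkQ_apply, Submodule.Quotient.mk_eq_zero, hN] at hg
    rw [← hr i, Ideal.Quotient.eq_zero_iff_mem]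
    refine hind r ?_ i
    simpa using hg
  have htop : ⊤ ≤ Submodule.span (R ⧸ maximalIdeal R) (Set.range v) := by
    have key : ∀ z ∈ Ideal.span (Set.range y), ∃ h : z ∈ maximalIdeal R ^ k,
        N.mkQ ⟨z, h⟩ ∈ Submodule.span (R ⧸ maximalIdeal R) (Set.range v) := by
      intro z hz
      induction hz using Submodule.span_induction with
      | mem z hz =>
        obtain ⟨i, rfl⟩ := hz
        exact ⟨hy i, Submodule.subset_span ⟨i, rfl⟩⟩
      | zero => exact ⟨zero_mem _, zero_mem _⟩
      | add x z _ _ hx hz =>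
        obtain ⟨h1, h2⟩ := hx
        obtain ⟨h3, h4⟩ := hz
        exact ⟨add_mem h1 h3, add_mem h2 h4⟩
      | smul a x _ hx =>
        obtain ⟨h1, h2⟩ := hx
        exact ⟨Ideal.mul_mem_left _ _ h1, Submodule.smul_mem _ (Ideal.Quotient.mk _ a) h2⟩
    rintro x -
    obtain ⟨⟨x, hx⟩, rfl⟩ := N.mkQ_surjective x
    obtain ⟨z, hz, w, hw, hzw⟩ := Submodule.mem_sup.1 (hspan hx)
    obtain ⟨h1, h2⟩ := key z hz
    have : N.mkQ ⟨x, hx⟩ = N.mkQ ⟨z, h1⟩ := by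
      rw [Submodule.mkQ_apply, Submodule.mkQ_apply, Submodule.Quotient.eq, hN]
      change x - z ∈ _
      rwa [← hzw, add_sub_cancel_left]
    rw [this]
    exact h2
  exact Module.finrank_eq_card_basis (Module.Basis.mk hv htop)

variable {m : ℕ} {R : Type u} [CommRing R]
  [Algebra (MonomialCurve.CoordinateRing K (familyExponents m)) R]
  [IsLocalization.AtPrime R (MonomialCurve.originIdeal K (familyExponents m))]

variable (K m R) in
/-- The canonical map from the polynomial ring to the local ring at the origin. -/
noncomputable def toLocalRing : MvPolynomial (Fin 4) K →+* R :=
  (algebraMap (MonomialCurve.CoordinateRing K (familyExponents m)) _).comp (Ideal.Quotient.mk _)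

theorem evalOrigin_mk (hm : 4 ≤ m) (f : MvPolynomial (Fin 4) K) :
    MonomialCurve.evalOrigin K (familyExponents m) (Ideal.Quotient.mk _ f) =
      constantCoeff f := by
  have : (MonomialCurve.evalOrigin K (familyExponents m)).comp (Ideal.Quotient.mk _) =
      constantCoeff := by
    apply MvPolynomial.ringHom_ext
    · intro r
      change Polynomial.eval 0 (MonomialCurve.parametrization K (familyExponents m) (C r)) = _
      simp [MonomialCurve.parametrization]
    · intro i
      change Polynomial.eval 0 (MonomialCurve.parametrization K (familyExponents m) (X i)) = _
      simp [MonomialCurve.parametrization, (familyExponents_pos hm i).ne']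
  exact congrArg (fun g => g f) this

theorem mk_mem_originIdeal (hm : 4 ≤ m) (f : MvPolynomial (Fin 4) K) :
    Ideal.Quotient.mk _ f ∈ MonomialCurve.originIdeal K (familyExponents m) ↔
      constantCoeff f = 0 := by
  rw [MonomialCurve.originIdeal, RingHom.mem_ker, evalOrigin_mk hm]

instance isPrime_toricIdeal (m : ℕ) :
    (MonomialCurve.toricIdeal K (familyExponents m)).IsPrime := RingHom.ker_isPrime _

theorem toLocalRing_eq_zero_iff (f : MvPolynomial (Fin 4) K) :
    toLocalRing K m R f = 0 ↔ f ∈ MonomialCurve.toricIdeal K (familyExponents m) := by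
  rw [toLocalRing, RingHom.comp_apply, ← Ideal.Quotient.eq_zero_iff_mem]
  exact map_eq_zero_iff _ (IsLocalization.injective R
    (MonomialCurve.originIdeal K (familyExponents m)).primeCompl_le_nonZeroDivisors)

theorem maximalIdeal_eq_map [IsLocalRing R] (hm : 4 ≤ m) :
    IsLocalRing.maximalIdeal R =
      (idealOfVars (Fin 4) K).map (toLocalRing K m R) := by
  rw [toLocalRing, ← Ideal.map_map, ← MonomialCurve.originIdeal_eq_map K (familyExponents m)
    (familyExponents_pos hm), IsLocalization.AtPrime.map_eq_maximalIdeal _ R]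

theorem isUnit_toLocalRing (hm : 4 ≤ m) {f : MvPolynomial (Fin 4) K}
    (hf : constantCoeff f ≠ 0) : IsUnit (toLocalRing K m R f) :=
  IsLocalization.map_units (M := (MonomialCurve.originIdeal K (familyExponents m)).primeCompl) _
    ⟨Ideal.Quotient.mk _ f, fun h => hf ((mk_mem_originIdeal hm f).1 h)⟩

theorem exists_mul_toLocalRing (hm : 4 ≤ m)
    (r : R) :
    ∃ f g, constantCoeff g ≠ 0 ∧ r * toLocalRing K m R g = toLocalRing K m R f := by
  obtain ⟨⟨x, s, hs⟩, h⟩ := IsLocalization.surj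
    (MonomialCurve.originIdeal K (familyExponents m)).primeCompl r
  obtain ⟨f, rfl⟩ := Ideal.Quotient.mk_surjective x
  obtain ⟨g, rfl⟩ := Ideal.Quotient.mk_surjective s
  exact ⟨f, g, fun hg => hs ((mk_mem_originIdeal hm g).2 hg), h⟩

/-- Clearing denominators turns membership in the local ring into a statement about polynomials, at
the price of a multiplier g with g(0) ≠ 0. -/
theorem toLocalRing_mem_map (hm : 4 ≤ m) {I : Ideal (MvPolynomial (Fin 4) K)}
    {f : MvPolynomial (Fin 4) K} (h : toLocalRing K m R f ∈ I.map (toLocalRing K m R)) :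
    ∃ g, constantCoeff g ≠ 0 ∧ ∃ p ∈ I,
      g * f - p ∈ MonomialCurve.toricIdeal K (familyExponents m) := by
  rw [toLocalRing, ← Ideal.map_map, RingHom.comp_apply,
    IsLocalization.algebraMap_mem_map_algebraMap_iff
      (MonomialCurve.originIdeal K (familyExponents m)).primeCompl] at h
  obtain ⟨s, hs, h⟩ := h
  obtain ⟨g, rfl⟩ := Ideal.Quotient.mk_surjective s
  rw [← map_mul, Ideal.mem_map_iff_of_surjective _ Ideal.Quotient.mk_surjective] at h
  obtain ⟨p, hp, h⟩ := h
  exact ⟨g, fun hg => hs ((mk_mem_originIdeal hm g).2 hg), p, hp, Ideal.Quotient.eq.1 h.symm⟩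

theorem toLocalRing_monomial_eq (hm : 4 ≤ m) {e f : Fin 4 →₀ ℕ}
    (h : weight m e = weight m f) :
    toLocalRing K m R (monomial e 1) = toLocalRing K m R (monomial f 1) := by
  rw [← sub_eq_zero, ← map_sub, toLocalRing_eq_zero_iff]
  exact monomial_sub_mem hm (binomials_subset_toricIdeal hm) h

theorem mem_idealOfVars_iff {f : MvPolynomial (Fin 4) K} :
    f ∈ idealOfVars (Fin 4) K ↔ constantCoeff f = 0 := by
  rw [← pow_one (idealOfVars (Fin 4) K), mem_pow_idealOfVars_iff']
  refine ⟨fun h => h 0 (by simp), fun h x hx => ?_⟩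
  rw [(Finsupp.degree_eq_zero_iff x).1 (by omega)]
  exact h

/-- The residue field at the origin is `K`. -/
theorem exists_sub_C_mem [IsLocalRing R] (hm : 4 ≤ m)
    (r : R) :
    ∃ c : K, r - toLocalRing K m R (C c) ∈
      IsLocalRing.maximalIdeal R := by
  obtain ⟨f, g, hg, h⟩ := exists_mul_toLocalRing (K := K) hm r
  refine ⟨constantCoeff f / constantCoeff g, ?_⟩
  rw [← Ideal.unit_mul_mem_iff_mem _ (isUnit_toLocalRing (R := R) hm hg), mul_sub, mul_comm _ r, h,
    ← map_mul, ← map_sub, maximalIdeal_eq_map (K := K) hm]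
  refine Ideal.mem_map_of_mem _ (mem_idealOfVars_iff.2 ?_)
  simp [mul_div_cancel₀ _ hg]

/-- After clearing denominators, gf - p lies in the toric ideal and has order at least k, so the
standard u does not occur in it. Since p has order above k, the coefficient at u is g(0) times that
of f. -/
theorem coeff_eq_zero_of_toLocalRing_mem [IsLocalRing R] (hm : 4 ≤ m) {k : ℕ}
    {f : MvPolynomial (Fin 4) K} (hf : f ∈ idealOfVars (Fin 4) K ^ k)
    (h : toLocalRing K m R f ∈
      IsLocalRing.maximalIdeal R ^ (k + 1))
    {u : Fin 4 →₀ ℕ} (hu : u ∈ standardOfDegree m k) : coeff u f = 0 := by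
  obtain ⟨hs, hd⟩ := mem_standardOfDegree.1 hu
  rw [maximalIdeal_eq_map (K := K) hm, ← Ideal.map_pow] at h
  obtain ⟨g, hg, p, hp, hmem⟩ := toLocalRing_mem_map hm h
  have h1 : g * f - p ∈ idealOfVars (Fin 4) K ^ k :=
    sub_mem (Ideal.mul_mem_left _ _ hf) (Ideal.pow_le_pow_right (Nat.le_succ k) hp)
  have h2 := coeff_standard_eq_zero hm hmem hs
    (by rw [hd]; exact (mem_pow_idealOfVars_iff k _).1 h1)
  rw [coeff_sub, coeff_mul_of_mem_pow hf g hd,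
    (mem_pow_idealOfVars_iff' (k + 1) p).1 hp u (by omega), sub_zero] at h2
  exact (mul_eq_zero.1 h2).resolve_left hg

variable (K) in
-- Standard monomials of degree k span 𝔪ᵏ/𝔪ᵏ⁺¹ because a nonstandard one equals a monomial of larger
-- degree. For independence, coefficients are replaced by their residues in K.
theorem localHilbertFunction_eq {m : ℕ} {R : Type u} [CommRing R] [IsLocalRing R]
    [Algebra (MonomialCurve.CoordinateRing K (familyExponents m)) R]
    [IsLocalization.AtPrime R (MonomialCurve.originIdeal K (familyExponents m))] (hm : 4 ≤ m) (k : ℕ) :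
    localHilbertFunction R k =
      (standardOfDegree m k).card := by
  classical
  have hpow : ∀ n, IsLocalRing.maximalIdeal R ^ n =
      (idealOfVars (Fin 4) K ^ n).map (toLocalRing K m R) := by
    intro n
    rw [maximalIdeal_eq_map (K := K) hm, Ideal.map_pow]
  have hmon : ∀ e : Fin 4 →₀ ℕ, ∀ n ≤ e.degree, toLocalRing K m R (monomial e 1) ∈
      IsLocalRing.maximalIdeal R ^ n := by
    intro e n hn
    rw [hpow]
    exact Ideal.mem_map_of_mem _ ((monomial_mem_pow_idealOfVars_iff _ _ one_ne_zero).2 hn)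
  rw [localHilbertFunction_eq_card
    (fun e : standardOfDegree m k => toLocalRing K m R (monomial e.1 1)), Fintype.card_coe]
  · intro e
    exact hmon _ _ (mem_standardOfDegree.1 e.2).2.ge
  · conv_lhs => rw [hpow, pow_idealOfVars_eq_span, Ideal.map_span]
    rw [Ideal.span_le]
    rintro _ ⟨_, ⟨e, he, rfl⟩, rfl⟩
    have hek : e.degree = k := he
    by_cases hs : Standard m e
    · exact Ideal.mem_sup_left (Ideal.subset_span ⟨⟨e, mem_standardOfDegree.2 ⟨hs, hek⟩⟩, rfl⟩)
    · obtain ⟨e', hw, hd, -⟩ := exists_larger_degree.{0} hm hs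
      refine Ideal.mem_sup_right ?_
      rw [← toLocalRing_monomial_eq hm hw]
      exact hmon _ _ (by omega)
  · intro g hg i
    choose c hc using fun i => exists_sub_C_mem (K := K) hm (g i)
    let f : MvPolynomial (Fin 4) K := ∑ e : standardOfDegree m k, C (c e) * monomial e.1 1
    have hf : f ∈ idealOfVars (Fin 4) K ^ k :=
      sum_mem fun e _ => Ideal.mul_mem_left _ _ ((monomial_mem_pow_idealOfVars_iff _ _
        one_ne_zero).2 (mem_standardOfDegree.1 e.2).2.ge)
    have hmem : toLocalRing K m R f ∈
        IsLocalRing.maximalIdeal R ^ (k + 1) := by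
      have h1 : toLocalRing K m R f = ∑ e : standardOfDegree m k,
          g e * toLocalRing K m R (monomial e.1 1) - ∑ e : standardOfDegree m k,
          (g e - toLocalRing K m R (C (c e))) * toLocalRing K m R (monomial e.1 1) := by
        rw [← Finset.sum_sub_distrib, map_sum]
        refine Finset.sum_congr rfl fun e _ => ?_
        rw [map_mul, sub_mul, sub_sub_cancel]
      rw [h1]
      refine sub_mem hg (sum_mem fun e _ => ?_)
      rw [pow_succ']
      exact Ideal.mul_mem_mul (hc e) (hmon _ _ (mem_standardOfDegree.1 e.2).2.ge)
    have hci : c i = 0 := by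
      rw [← coeff_eq_zero_of_toLocalRing_mem hm hf hmem i.2, coeff_sum, Finset.sum_eq_single i]
      · rw [coeff_C_mul, coeff_monomial, if_pos rfl, mul_one]
      · intro e _ he
        rw [coeff_C_mul, coeff_monomial, if_neg fun h => he (Subtype.ext h), mul_zero]
      · simp
    have := hc i
    rwa [hci, map_zero, map_zero, sub_zero] at this

end RossiCurve

namespace RossiCurve

/-! ### Criteria for local rings -/

section LocalCriteria

open IsLocalRing

variable {R : Type*} [CommRing R] [IsLocalRing R]

/-- A Noetherian local domain that is not a field and whose maximal ideal is the radical of a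
principal ideal has dimension one. -/
theorem ringKrullDim_eq_one_of_le_radical [IsDomain R] [IsNoetherianRing R] {a : R}
    (ha : a ∈ maximalIdeal R) (h0 : a ≠ 0)
    (hrad : maximalIdeal R ≤ (Ideal.span {a}).radical) : ringKrullDim R = 1 := by
  rw [← maximalIdeal_height_eq_ringKrullDim]
  have hle : (maximalIdeal R).height ≤ 1 := by
    refine Ideal.height_le_one_of_isPrincipal_of_mem_minimalPrimes (Ideal.span {a}) _
      ⟨⟨inferInstance, (Ideal.span_singleton_le_iff_mem _).2 ha⟩, ?_⟩
    rintro q ⟨hq, hle⟩ -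
    exact hrad.trans ((Ideal.IsPrime.radical_le_iff hq).2 hle)
  have hne : (maximalIdeal R).height ≠ 0 := by
    rw [Ne, Ideal.height_eq_zero_iff_eq_bot]
    intro h
    rw [h, Ideal.mem_bot] at ha
    exact h0 ha
  exact_mod_cast le_antisymm hle (Order.one_le_iff_ne_zero.2 hne)

/-- A criterion for a local ring to be Gorenstein, in terms of a socle generator `s`. -/
theorem isGorensteinLocalRing_of_socle [IsNoetherianRing R] {rs : List R}
    (hrs : ∀ r ∈ rs, r ∈ maximalIdeal R) (hreg : RingTheory.Sequence.IsWeaklyRegular R rs)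
    (hrad : maximalIdeal R ≤ (Ideal.ofList rs).radical) {s : R} (hs : s ∉ Ideal.ofList rs)
    (hms : ∀ x ∈ maximalIdeal R, x * s ∈ Ideal.ofList rs)
    (hsoc : ∀ y, (∀ x ∈ maximalIdeal R, x * y ∈ Ideal.ofList rs) →
      ∃ r, y - r * s ∈ Ideal.ofList rs) : IsGorensteinLocalRing R := by
  have hJ : Ideal.ofList rs ≠ ⊤ := fun h => hs (h ▸ Submodule.mem_top)
  refine ⟨inferInstance, rs, hrs, ⟨hreg, ?_⟩, ?_, ?_⟩
  · rw [smul_eq_mul, Ideal.mul_top]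
    exact hJ.symm
  · have : Nontrivial (R ⧸ Ideal.ofList rs) := Ideal.Quotient.nontrivial_iff.2 hJ
    have : IsLocalRing (R ⧸ Ideal.ofList rs) :=
      IsLocalRing.of_surjective' _ Ideal.Quotient.mk_surjective
    rw [isArtinianRing_iff_isNilpotent_maximalIdeal]
    obtain ⟨n, hn⟩ := Ideal.exists_pow_le_of_le_radical_of_fg hrad
      (IsNoetherian.noetherian (maximalIdeal R))
    refine ⟨n, ?_⟩
    have hmap : maximalIdeal (R ⧸ Ideal.ofList rs) ≤
        (maximalIdeal R).map (Ideal.Quotient.mk (Ideal.ofList rs)) := by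
      intro x hx
      obtain ⟨x, rfl⟩ := Ideal.Quotient.mk_surjective x
      refine Ideal.mem_map_of_mem _ ?_
      rw [mem_maximalIdeal, mem_nonunits_iff] at hx ⊢
      exact fun h => hx (h.map _)
    rw [Ideal.zero_eq_bot, eq_bot_iff]
    refine (Ideal.pow_right_mono hmap n).trans ?_
    rw [← Ideal.map_pow]
    refine (Ideal.map_mono hn).trans ?_
    rw [Ideal.map_quotient_self]
  · have hmem : ∀ y : R, Ideal.Quotient.mk (Ideal.ofList rs) y ∈
        Submodule.torsionBySet R (R ⧸ Ideal.ofList rs) (maximalIdeal R : Set R) ↔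
        ∀ x ∈ maximalIdeal R, x * y ∈ Ideal.ofList rs := by
      intro y
      rw [Submodule.mem_torsionBySet_iff, Subtype.forall]
      refine forall₂_congr fun x _ => ?_
      rw [← Ideal.Quotient.eq_zero_iff_mem, map_mul]
      rfl
    rw [isSimpleModule_iff_toSpanSingleton_surjective]
    refine ⟨⟨⟨⟨_, (hmem s).2 hms⟩, 0, fun h => hs ?_⟩⟩, ?_⟩
    · exact Ideal.Quotient.eq_zero_iff_mem.1 (congrArg Subtype.val h)
    · rintro ⟨x, hx⟩ hx0 ⟨z, hz⟩
      obtain ⟨x, rfl⟩ := Ideal.Quotient.mk_surjective x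
      obtain ⟨z, rfl⟩ := Ideal.Quotient.mk_surjective z
      obtain ⟨r, hr⟩ := hsoc x ((hmem x).1 hx)
      obtain ⟨t, ht⟩ := hsoc z ((hmem z).1 hz)
      -- Were r a nonunit, r * s and hence x would vanish in the quotient. So any nonzero socle
      -- element generates s, and with it the whole socle.
      have hru : IsUnit r := by
        by_contra hu
        refine hx0 (Subtype.ext (Ideal.Quotient.eq_zero_iff_mem.2 ?_))
        have := add_mem hr (hms r ((mem_maximalIdeal r).2 hu))
        rwa [sub_add_cancel] at this
      obtain ⟨u, rfl⟩ := hru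
      refine ⟨t * ↑u⁻¹, Subtype.ext ?_⟩
      change Ideal.Quotient.mk _ ((t * ↑u⁻¹) * x) = Ideal.Quotient.mk _ z
      rw [Ideal.Quotient.eq]
      have h1 : t * ↑u⁻¹ * x - z = t * ↑u⁻¹ * (x - ↑u * s) - (z - t * s) := by
        have : (↑u⁻¹ : R) * ↑u = 1 := u.inv_mul
        linear_combination (t * s) * this
      rw [h1]
      exact sub_mem (Ideal.mul_mem_left _ _ hr) ht

/-- A Noetherian local domain with principal maximal ideal is Gorenstein. -/
theorem isGorensteinLocalRing_of_principal [IsDomain R] [IsNoetherianRing R] {p : R}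
    (hp : maximalIdeal R = Ideal.span {p}) : IsGorensteinLocalRing R := by
  obtain ⟨rs, hJ, hreg⟩ : ∃ rs : List R, Ideal.ofList rs = maximalIdeal R ∧
      RingTheory.Sequence.IsWeaklyRegular R rs := by
    -- For a field the regular sequence is empty. In both cases the quotient is the residue field,
    -- so 1 generates the socle.
    by_cases h0 : p = 0
    · exact ⟨[], by rw [hp, h0]; simp, .nil R R⟩
    · exact ⟨[p], by rw [hp, Ideal.ofList_singleton],
        (RingTheory.Sequence.isWeaklyRegular_singleton_iff R p).2
          (IsSMulRegular.of_ne_zero h0)⟩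
  refine isGorensteinLocalRing_of_socle (rs := rs) (s := 1) (fun r hr => ?_) hreg ?_ ?_ ?_ ?_
  · rw [← hJ]
    exact Ideal.subset_span hr
  · rw [hJ]
    exact Ideal.le_radical
  · rw [hJ]
    exact fun h => (Ideal.ne_top_iff_one _).1 (maximalIdeal.isMaximal R).ne_top h
  · intro x hx
    rwa [hJ, mul_one]
  · intro y _
    exact ⟨y, by simp⟩

end LocalCriteria

/-! ### The Apéry set of the semigroup -/

section Apery

/-- `s` is the weight of a monomial divisible by the first variable. -/
def IsShifted (m s : ℕ) : Prop :=
  ∃ e, s = weight m (e + expVec 1 0 0 0)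

theorem isShifted_of_weight_eq {m : ℕ} (hm : 4 ≤ m) (e : Fin 4 →₀ ℕ) {i j k l : ℕ}
    (h : (weight m e : ℤ) = weight m (expVec (i + 1) j k l)) : IsShifted m (weight m e) := by
  refine ⟨expVec i j k l, ?_⟩
  have : (weight m e : ℤ) = weight m (expVec i j k l + expVec 1 0 0 0) := by
    rw [h, weight_cast hm, weight_cast hm]
    simp
  exact_mod_cast this

/-- For a standard monomial e, the standard form of x₁·e either contains x₁ or is a power of x₂ with
exponent at least m: x₁ᵐ⁺²x₃ becomes x₂²ᵐ and x₁x₂ʲx₄ becomes x₂ᵐ⁺ʲ. Neither has the form x₂ʲx₄ˡ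
with j < m. -/
theorem not_isShifted {m : ℕ} (hm : 4 ≤ m) {j l : ℕ} (hj : j < m) (hl : l ≤ 1) :
    ¬ IsShifted m (weight m (expVec 0 j 0 l)) := by
  rintro ⟨e₀, he⟩
  obtain ⟨e, hs, hw, -⟩ := exists_standard.{0} hm e₀
  rw [weight_add, ← hw, ← weight_add] at he
  have hu : Standard m (expVec 0 j 0 l) := by
    rcases Nat.le_one_iff_eq_zero_or_eq_one.1 hl with rfl | rfl
    · exact Or.inl ⟨by simp; omega, rfl, rfl⟩
    · exact Or.inr (Or.inr ⟨rfl, hj, rfl, rfl⟩)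
  have key : ∀ f, Standard m f → (weight m f : ℤ) = weight m (e + expVec 1 0 0 0) →
      (f 0 = 0 ∧ f 1 = j ∧ f 2 = 0) := by
    intro f hf hfe
    rw [← hu.ext hm hf (he.trans (by exact_mod_cast hfe.symm))]
    simp
  by_cases h1 : Standard m (e + expVec 1 0 0 0)
  · have := (key _ h1 rfl).1
    simp at this
  · rw [weight_cast hm] at key
    rcases hs with ⟨a1, a2, a3⟩ | ⟨a0, a1, a2, a3⟩ | ⟨a0, a1, a2, a3⟩
    · exact h1 (Or.inl ⟨by simpa using a1, by simpa using a2, by simpa using a3⟩)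
    · by_cases hlt : e 0 < m + 1
      · exact h1 (Or.inr (Or.inl ⟨by simpa using hlt, by simpa using a1, by simpa using a2,
          by simpa using a3⟩))
      · have h0 : e 0 = m + 1 := by omega
        have := key (expVec 0 (2 * m) 0 0) (Or.inl ⟨le_rfl, rfl, rfl⟩) (by
          rw [weight_cast hm]
          simp [h0, a1, a2, a3]
          ring)
        simp at this
        omega
    · have := key (expVec 0 (m + e 1) 0 0) (Or.inl ⟨by simp; omega, rfl, rfl⟩) (by
          rw [weight_cast hm]
          simp [a0, a2, a3]
          ring)
      simp at this
      omega

/-- The nontrivial products are x₂ᵐx₄ = x₁ᵐ⁺¹x₃, x₂ᵐ⁻¹x₃x₄ = x₁ᵐx₂²ᵐ⁻² and x₂ᵐ⁻¹x₄² = x₁ᵐx₂ᵐ⁻¹x₃. -/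
theorem isShifted_socle {m : ℕ} (hm : 4 ≤ m) (i : Fin 4) :
    IsShifted m (weight m (expVec 0 (m - 1) 0 1 + Finsupp.single i 1)) := by
  have hm1 : ((m - 1 : ℕ) : ℤ) = m - 1 := by omega
  fin_cases i
  · exact isShifted_of_weight_eq hm _ (i := 0) (j := m - 1) (k := 0) (l := 1) (by
      simp only [weight_cast hm]; simp)
  · exact isShifted_of_weight_eq hm _ (i := m) (j := 0) (k := 1) (l := 0) (by
      simp only [weight_cast hm]; simp [hm1]; ring)
  · exact isShifted_of_weight_eq hm _ (i := m - 1) (j := m - 1 + (m - 1)) (k := 0) (l := 0) (by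
      simp only [weight_cast hm]; simp [hm1]; ring)
  · exact isShifted_of_weight_eq hm _ (i := m - 1) (j := m - 1) (k := 1) (l := 0) (by
      simp only [weight_cast hm]; simp [hm1]; ring)

/-- The semigroup is symmetric: its Apéry set has a unique maximal element. -/
theorem weight_eq_socle {m : ℕ} (hm : 4 ≤ m) {e : Fin 4 →₀ ℕ} (he : ¬ IsShifted m (weight m e))
    (h : ∀ i, IsShifted m (weight m (e + Finsupp.single i 1))) :
    weight m e = weight m (expVec 0 (m - 1) 0 1) := by
  have hm1 : ((m - 1 : ℕ) : ℤ) = m - 1 := by omega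
  obtain ⟨f, hs, hw, -⟩ := exists_standard.{0} hm e
  simp only [weight_add, ← hw] at he h ⊢
  simp only [← weight_add] at h
  have contra : ∀ (i : Fin 4) {j l : ℕ}, j < m → l ≤ 1 →
      (weight m (f + Finsupp.single i 1) : ℤ) = weight m (expVec 0 j 0 l) → False := by
    intro i j l hj hl hij
    have : weight m (f + Finsupp.single i 1) = weight m (expVec 0 j 0 l) := by exact_mod_cast hij
    exact not_isShifted hm hj hl (this ▸ h i)
  have h0 : f 0 = 0 := by
    by_contra hne
    obtain ⟨n, hn⟩ := Nat.exists_eq_succ_of_ne_zero hne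
    refine he (isShifted_of_weight_eq hm _ (i := n) (j := f 1) (k := f 2) (l := f 3) ?_)
    rw [← Nat.succ_eq_add_one, ← hn, expVec_eta]
  -- Each other candidate fails. A power x₂ʲ stays unshifted after multiplication by x₂ if j < m-1
  -- and by x₄ if j = m-1, and is itself shifted if j ≥ m. For x₃, the square x₃² = x₂ᵐ⁻¹x₄ is
  -- unshifted. For x₂ʲx₄ with j < m-1, multiply by x₂.
  rcases hs with ⟨a1, a2, a3⟩ | ⟨a0, a1, a2, a3⟩ | ⟨a0, a1, a2, a3⟩
  · exfalso
    rcases Nat.lt_or_ge (f 1) m with hlt | hge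
    · rcases Nat.lt_or_ge (f 1 + 1) m with hlt' | hge'
      · exact contra 1 (l := 0) hlt' (Nat.zero_le _) (by
          simp only [weight_cast hm]; simp [h0, a2, a3])
      · exact contra 3 hlt le_rfl (by
          simp only [weight_cast hm]; simp [h0, a2, a3])
    · obtain ⟨n, hn⟩ := Nat.exists_eq_add_of_le hge
      refine he (isShifted_of_weight_eq hm _ (i := 0) (j := n) (k := 0) (l := 1) ?_)
      simp only [weight_cast hm]
      simp [h0, a2, a3, hn]
      ring
  · exfalso
    exact contra 2 (show m - 1 < m by omega) le_rfl (by
      simp only [weight_cast hm]; simp [h0, a1, a2, a3, hm1]; ring)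
  · rcases Nat.lt_or_ge (f 1 + 1) m with hlt | hge
    · exact (contra 1 hlt le_rfl (by
        simp only [weight_cast hm]; simp [a0, a2, a3])).elim
    · congr 1
      exact exp_ext h0 (by simp; omega) a2 a3

end Apery

end RossiCurve

namespace RossiCurve

open MvPolynomial

variable {K : Type u} [Field K] {m : ℕ}

/-! ### The curve is Gorenstein -/

theorem coeff_parametrization_ne_zero {f : MvPolynomial (Fin 4) K} {s : ℕ}
    (h : (MonomialCurve.parametrization K (familyExponents m) f).coeff s ≠ 0) :
    ∃ e, weight m e = s := by
  rw [coeff_parametrization] at h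
  obtain ⟨e, he, -⟩ := Finset.exists_ne_zero_of_sum_ne_zero h
  exact ⟨e, (Finset.mem_filter.1 he).2⟩

theorem parametrization_mul_monomial_coeff (f : MvPolynomial (Fin 4) K) (e : Fin 4 →₀ ℕ) (s : ℕ) :
    (MonomialCurve.parametrization K (familyExponents m) (f * monomial e 1)).coeff
      (s + weight m e) = (MonomialCurve.parametrization K (familyExponents m) f).coeff s := by
  rw [map_mul, parametrization_monomial, Polynomial.monomial_one_right_eq_X_pow,
    Polynomial.coeff_mul_X_pow]

theorem X_eq_monomial_expVec : (X 0 : MvPolynomial (Fin 4) K) = monomial (expVec 1 0 0 0) 1 := by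
  simp [monomial_eq_monomialValue, monomialValue]

/-- Membership in the ideal generated by the toric ideal and the first variable. -/
theorem mem_span_X_sup_toricIdeal {f : MvPolynomial (Fin 4) K} :
    f ∈ Ideal.span {X 0} ⊔ MonomialCurve.toricIdeal K (familyExponents m) ↔
      ∀ s, (MonomialCurve.parametrization K (familyExponents m) f).coeff s ≠ 0 →
        IsShifted m s := by
  constructor
  · intro hf s hs
    obtain ⟨p, hp, q, hq, rfl⟩ := Submodule.mem_sup.1 hf
    obtain ⟨g, rfl⟩ := Ideal.mem_span_singleton'.1 hp
    rw [map_add, (RingHom.mem_ker.1 hq : MonomialCurve.parametrization K _ q = 0), add_zero,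
      X_eq_monomial_expVec, map_mul, parametrization_monomial,
      Polynomial.monomial_one_right_eq_X_pow, Polynomial.coeff_mul_X_pow'] at hs
    split_ifs at hs with hle
    · obtain ⟨e, he⟩ := coeff_parametrization_ne_zero hs
      exact ⟨e, by rw [weight_add]; omega⟩
    · exact absurd rfl hs
  · intro h
    let φ := MonomialCurve.parametrization K (familyExponents m)
    -- Each weight in the image of f is that of x₁ times a monomial. Collecting these monomials
    -- gives g for which g·x₁ and f have the same image.
    choose! e he using h
    let g : MvPolynomial (Fin 4) K := ∑ s ∈ (φ f).support, monomial (e s) ((φ f).coeff s)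
    have hg : φ (g * X 0) = φ f := by
      conv_rhs => rw [(φ f).as_sum_support]
      rw [Finset.sum_mul, map_sum]
      refine Finset.sum_congr rfl fun s hs => ?_
      rw [X_eq_monomial_expVec, monomial_mul, mul_one, parametrization_monomial,
        ← he s (Polynomial.mem_support_iff.1 hs)]
    have hdiff : f - g * X 0 ∈ MonomialCurve.toricIdeal K (familyExponents m) := by
      rw [MonomialCurve.toricIdeal, RingHom.mem_ker, map_sub, sub_eq_zero]
      exact hg.symm
    have := add_mem (Ideal.mem_sup_left (Ideal.mul_mem_left _ g
      (Ideal.mem_span_singleton_self (X 0)))) (Ideal.mem_sup_right (S := Ideal.span {X 0}) hdiff)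
    rwa [add_sub_cancel] at this

/-- Both powers map to the same power of t. Consequently all variables are nilpotent modulo any one
of them. -/
theorem X_pow_sub_mem (i j : Fin 4) :
    (X i : MvPolynomial (Fin 4) K) ^ familyExponents m j - X j ^ familyExponents m i ∈
      MonomialCurve.toricIdeal K (familyExponents m) := by
  have hX : ∀ i, MonomialCurve.parametrization K (familyExponents m) (X i) =
      Polynomial.X ^ familyExponents m i := fun i => aeval_X _ i
  rw [MonomialCurve.toricIdeal, RingHom.mem_ker, map_sub, map_pow, map_pow, hX, hX, ← pow_mul,
    ← pow_mul, mul_comm, sub_self]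

theorem isMaximal_idealOfVars : (idealOfVars (Fin 4) K).IsMaximal := by
  have : idealOfVars (Fin 4) K = RingHom.ker (constantCoeff (R := K) (σ := Fin 4)) := by
    ext f
    rw [mem_idealOfVars_iff, RingHom.mem_ker]
  rw [this]
  exact RingHom.ker_isMaximal_of_surjective _ fun r => ⟨C r, constantCoeff_C _ r⟩

/-- The ideal has maximal radical, the ideal of the origin, so it is primary and a factor not
vanishing at the origin can be cancelled. -/
theorem mem_of_mul_mem (hm : 4 ≤ m) {f g : MvPolynomial (Fin 4) K} (hg : constantCoeff g ≠ 0)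
    (h : g * f ∈ Ideal.span {X 0} ⊔ MonomialCurve.toricIdeal K (familyExponents m)) :
    f ∈ Ideal.span {X 0} ⊔ MonomialCurve.toricIdeal K (familyExponents m) := by
  set Q := Ideal.span {X 0} ⊔ MonomialCurve.toricIdeal K (familyExponents m) with hQ
  have hQle : Q ≤ idealOfVars (Fin 4) K := sup_le
    ((Ideal.span_singleton_le_iff_mem _).2 (Ideal.subset_span ⟨0, rfl⟩))
    ((toricIdeal_le_sq hm).trans (Ideal.pow_le_self two_ne_zero))
  have hQne : Q ≠ ⊤ := fun h => idealOfVars_ne_top (K := K) (top_le_iff.1 (h ▸ hQle))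
  have hle : idealOfVars (Fin 4) K ≤ Q.radical := by
    rw [Ideal.span_le]
    rintro _ ⟨i, rfl⟩
    refine ⟨familyExponents m 0, ?_⟩
    have := add_mem (Ideal.mem_sup_right (S := Ideal.span {X 0}) (X_pow_sub_mem (K := K) (m := m) i 0))
      (Ideal.mem_sup_left (Ideal.pow_mem_of_mem _ (Ideal.mem_span_singleton_self (X 0)) _
        (familyExponents_pos hm i)))
    rwa [sub_add_cancel] at this
  have hrad : Q.radical = idealOfVars (Fin 4) K :=
    ((isMaximal_idealOfVars (K := K)).eq_of_le
      (fun h => hQne (Ideal.radical_eq_top.1 h)) hle).symm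
  have hprim : Q.IsPrimary := Ideal.isPrimary_of_isMaximal_radical (hrad ▸ isMaximal_idealOfVars)
  rcases (Ideal.isPrimary_iff.1 hprim).2 (mul_comm g f ▸ h) with h | h
  · exact h
  · rw [hrad, mem_idealOfVars_iff] at h
    exact (hg h).elim

/-- The socle modulo the first variable is generated by `x₂ᵐ⁻¹ x₄`. -/
theorem exists_sub_socle_mem (hm : 4 ≤ m) {f : MvPolynomial (Fin 4) K}
    (h : ∀ i, f * X i ∈ Ideal.span {X 0} ⊔ MonomialCurve.toricIdeal K (familyExponents m)) :
    ∃ c : K, f - C c * monomial (expVec 0 (m - 1) 0 1) 1 ∈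
      Ideal.span {X 0} ⊔ MonomialCurve.toricIdeal K (familyExponents m) := by
  -- Subtracting this coefficient removes the socle weight. A remaining unshifted weight would
  -- become shifted after multiplication by every variable, hence would equal the socle weight.
  refine ⟨(MonomialCurve.parametrization K (familyExponents m) f).coeff
    (weight m (expVec 0 (m - 1) 0 1)), ?_⟩
  rw [mem_span_X_sup_toricIdeal]
  intro s hs
  rw [C_mul_monomial, mul_one, map_sub, parametrization_monomial, Polynomial.coeff_sub,
    Polynomial.coeff_monomial] at hs
  split_ifs at hs with hsw
  · rw [hsw, sub_self] at hs
    exact absurd rfl hs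
  · rw [sub_zero] at hs
    by_contra hns
    obtain ⟨e, rfl⟩ := coeff_parametrization_ne_zero hs
    refine hsw (weight_eq_socle hm hns fun i => ?_).symm
    rw [weight_add]
    refine mem_span_X_sup_toricIdeal.1 (h i) _ ?_
    rw [X, parametrization_mul_monomial_coeff]
    exact hs

theorem socle_mul_X_mem (hm : 4 ≤ m) (i : Fin 4) :
    monomial (expVec 0 (m - 1) 0 1) (1 : K) * X i ∈
      Ideal.span {X 0} ⊔ MonomialCurve.toricIdeal K (familyExponents m) := by
  rw [mem_span_X_sup_toricIdeal]
  intro s hs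
  rw [X, monomial_mul, mul_one, parametrization_monomial, Polynomial.coeff_monomial] at hs
  split_ifs at hs with h
  · rw [← h]
    exact isShifted_socle hm i
  · exact absurd rfl hs

theorem socle_notMem (hm : 4 ≤ m) :
    monomial (expVec 0 (m - 1) 0 1) (1 : K) ∉
      Ideal.span {X 0} ⊔ MonomialCurve.toricIdeal K (familyExponents m) := by
  intro h
  refine not_isShifted hm (show m - 1 < m by omega) le_rfl (mem_span_X_sup_toricIdeal.1 h _ ?_)
  rw [parametrization_monomial, Polynomial.coeff_monomial, if_pos rfl]
  exact one_ne_zero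

section Origin

variable {R : Type u} [CommRing R]
  [Algebra (MonomialCurve.CoordinateRing K (familyExponents m)) R]
  [IsLocalization.AtPrime R (MonomialCurve.originIdeal K (familyExponents m))]

theorem toLocalRing_mem_span (hm : 4 ≤ m) {f : MvPolynomial (Fin 4) K} :
    toLocalRing K m R f ∈ Ideal.span {toLocalRing K m R (X 0)} ↔
      f ∈ Ideal.span {X 0} ⊔ MonomialCurve.toricIdeal K (familyExponents m) := by
  have hmap : Ideal.span {toLocalRing K m R (X 0)} =
      (Ideal.span {X 0}).map (toLocalRing K m R) := by
    rw [Ideal.map_span, Set.image_singleton]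
  rw [hmap]
  constructor
  · intro h
    obtain ⟨g, hg, p, hp, hmem⟩ := toLocalRing_mem_map hm h
    refine mem_of_mul_mem hm hg ?_
    have := add_mem (Ideal.mem_sup_right (S := Ideal.span {X 0}) hmem) (Ideal.mem_sup_left hp)
    rwa [sub_add_cancel] at this
  · intro h
    obtain ⟨p, hp, q, hq, rfl⟩ := Submodule.mem_sup.1 h
    rw [map_add, (toLocalRing_eq_zero_iff (R := R) q).2 hq, add_zero]
    exact Ideal.mem_map_of_mem _ hp

theorem toLocalRing_X_ne_zero : toLocalRing K m R (X 0) ≠ 0 := by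
  rw [Ne, toLocalRing_eq_zero_iff, MonomialCurve.toricIdeal, RingHom.mem_ker]
  intro h
  rw [X, parametrization_monomial, Polynomial.monomial_eq_zero_iff] at h
  exact one_ne_zero h

theorem maximalIdeal_le_radical [IsLocalRing R] (hm : 4 ≤ m) :
    IsLocalRing.maximalIdeal R ≤ (Ideal.span {toLocalRing K m R (X 0)}).radical := by
  rw [maximalIdeal_eq_map (K := K) hm, Ideal.map_span, Ideal.span_le]
  rintro _ ⟨_, ⟨i, rfl⟩, rfl⟩
  refine ⟨familyExponents m 0, ?_⟩
  have := (toLocalRing_eq_zero_iff (R := R) _).2 (X_pow_sub_mem (K := K) (m := m) i 0)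
  rw [map_sub, map_pow, map_pow, sub_eq_zero] at this
  rw [this]
  exact Ideal.pow_mem_of_mem _ (Ideal.mem_span_singleton_self _) _ (familyExponents_pos hm i)

theorem toLocalRing_X_mem [IsLocalRing R] (hm : 4 ≤ m) (i : Fin 4) :
    toLocalRing K m R (X i) ∈ IsLocalRing.maximalIdeal R := by
  rw [maximalIdeal_eq_map (K := K) hm]
  exact Ideal.mem_map_of_mem _ (Ideal.subset_span ⟨i, rfl⟩)

end Origin

/-- The local ring at the origin is Gorenstein of dimension one. -/
theorem isGorensteinLocalRing_origin (K : Type u) [Field K] {m : ℕ} (hm : 4 ≤ m)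
    (R : Type u) [CommRing R] [IsLocalRing R]
    [Algebra (MonomialCurve.CoordinateRing K (familyExponents m)) R]
    [IsLocalization.AtPrime R (MonomialCurve.originIdeal K (familyExponents m))] :
    IsGorensteinLocalRing R ∧ ringKrullDim R = 1 := by
  have : IsDomain R :=
    IsLocalization.isDomain_of_atPrime R (MonomialCurve.originIdeal K (familyExponents m))
  have : IsNoetherianRing R := IsLocalization.isNoetherianRing
    (MonomialCurve.originIdeal K (familyExponents m)).primeCompl R inferInstance
  refine ⟨?_, ringKrullDim_eq_one_of_le_radical (toLocalRing_X_mem (K := K) hm 0)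
    toLocalRing_X_ne_zero (maximalIdeal_le_radical hm)⟩
  refine isGorensteinLocalRing_of_socle (rs := [toLocalRing K m R (X 0)])
    (s := toLocalRing K m R (monomial (expVec 0 (m - 1) 0 1) 1)) ?_ ?_ ?_ ?_ ?_ ?_
  · intro r hr
    rw [List.mem_singleton.1 hr]
    exact toLocalRing_X_mem hm 0
  · exact (RingTheory.Sequence.isWeaklyRegular_singleton_iff R _).2
      (IsSMulRegular.of_ne_zero toLocalRing_X_ne_zero)
  · rw [Ideal.ofList_singleton]
    exact maximalIdeal_le_radical hm
  · rw [Ideal.ofList_singleton, toLocalRing_mem_span hm]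
    exact socle_notMem hm
  · intro x hx
    rw [Ideal.ofList_singleton]
    rw [maximalIdeal_eq_map (K := K) hm, Ideal.map_span] at hx
    induction hx using Submodule.span_induction with
    | mem x hx =>
      obtain ⟨_, ⟨i, rfl⟩, rfl⟩ := hx
      rw [← map_mul, toLocalRing_mem_span hm, mul_comm]
      exact socle_mul_X_mem hm i
    | zero => rw [zero_mul]; exact zero_mem _
    | add x y _ _ hx hy => rw [add_mul]; exact add_mem hx hy
    | smul a x _ hx => rw [smul_eq_mul, mul_assoc]; exact Ideal.mul_mem_left _ _ hx
  · intro y hy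
    rw [Ideal.ofList_singleton] at hy ⊢
    obtain ⟨f, g, hg, hfg⟩ := exists_mul_toLocalRing (K := K) hm y
    obtain ⟨c, hc⟩ := exists_sub_socle_mem hm (f := f) fun i => by
      rw [← toLocalRing_mem_span (R := R) hm, map_mul, ← hfg, mul_right_comm, mul_comm y]
      exact Ideal.mul_mem_right _ _ (hy _ (toLocalRing_X_mem hm i))
    obtain ⟨u, hu⟩ := isUnit_toLocalRing (R := R) hm hg
    refine ⟨↑u⁻¹ * toLocalRing K m R (C c), ?_⟩
    rw [← toLocalRing_mem_span (R := R) hm, map_sub, map_mul, ← hfg, ← hu] at hc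
    have := Ideal.mul_mem_left _ (↑u⁻¹ : R) hc
    have hinv : (↑u⁻¹ : R) * ↑u = 1 := u.inv_mul
    convert this using 1
    linear_combination -y * hinv

/-! ### Points away from the origin -/

/-- Away from the origin the curve is regular. -/
theorem isGorensteinLocalRing_of_ne_origin (hm : 4 ≤ m)
    (P : Ideal (MonomialCurve.CoordinateRing K (familyExponents m))) [P.IsMaximal]
    (hP : P ≠ MonomialCurve.originIdeal K (familyExponents m)) {R : Type u} [CommRing R]
    [IsLocalRing R] [Algebra (MonomialCurve.CoordinateRing K (familyExponents m)) R]
    [IsLocalization.AtPrime R P] : IsGorensteinLocalRing R := by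
  have : IsDomain R := IsLocalization.isDomain_of_atPrime R P
  have : IsNoetherianRing R := IsLocalization.isNoetherianRing P.primeCompl R inferInstance
  let π := Ideal.Quotient.mk (MonomialCurve.toricIdeal K (familyExponents m))
  have hπ : ∀ i j, π (X i) ^ familyExponents m j = π (X j) ^ familyExponents m i := by
    intro i j
    rw [← map_pow, ← map_pow]
    exact Ideal.Quotient.eq.2 (X_pow_sub_mem i j)
  have hmax : (MonomialCurve.originIdeal K (familyExponents m)).IsMaximal :=
    RingHom.ker_isMaximal_of_surjective _ fun r => ⟨π (C r), by simp [π, evalOrigin_mk hm]⟩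
  -- If x₃ were in P, so would be a power of every variable, forcing P to be the origin.
  have h2 : π (X 2) ∉ P := by
    intro h
    refine hP (hmax.eq_of_le (Ideal.IsMaximal.ne_top inferInstance) ?_).symm
    rw [MonomialCurve.originIdeal_eq_map K _ (familyExponents_pos hm), Ideal.map_span,
      Ideal.span_le]
    rintro _ ⟨_, ⟨i, rfl⟩, rfl⟩
    refine Ideal.IsPrime.mem_of_pow_mem (I := P) inferInstance (familyExponents m 2) ?_
    change π (X i) ^ _ ∈ P
    rw [hπ i 2]
    exact Ideal.pow_mem_of_mem _ h _ (familyExponents_pos hm i)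
  let ψ : MvPolynomial (Fin 4) K →+* R :=
    (algebraMap (MonomialCurve.CoordinateRing K (familyExponents m)) R).comp π
  obtain ⟨w, hw⟩ : IsUnit (ψ (X 2)) := IsLocalization.map_units (M := P.primeCompl) R ⟨_, h2⟩
  -- The last two exponents differ by 1, so x₄/x₃ recovers the parameter t.
  let t : R := ψ (X 3) * ↑w⁻¹
  let θ : Polynomial K →+* R := Polynomial.eval₂RingHom (ψ.comp C) t
  have hθ : ∀ f, θ (MonomialCurve.parametrization K (familyExponents m) f) = ψ f := by
    have : θ.comp (MonomialCurve.parametrization K (familyExponents m)) = ψ := by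
      apply MvPolynomial.ringHom_ext
      · intro r
        simp [θ, MonomialCurve.parametrization]
      · intro i
        have h1 : MonomialCurve.parametrization K (familyExponents m) (X i) =
            Polynomial.X ^ familyExponents m i := aeval_X _ i
        have hw2 : (↑w⁻¹ : R) * ψ (X 2) = 1 := by rw [← hw]; exact w.inv_mul
        have h3 : ψ (X 3) ^ familyExponents m i = ψ (X i) * ψ (X 2) ^ familyExponents m i := by
          have hker : (X 3 : MvPolynomial (Fin 4) K) ^ familyExponents m i -
              X i * X 2 ^ familyExponents m i ∈
              MonomialCurve.toricIdeal K (familyExponents m) := by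
            have hX : ∀ i, MonomialCurve.parametrization K (familyExponents m) (X i) =
              Polynomial.X ^ familyExponents m i := fun i => aeval_X _ i
            have h32 : familyExponents m 3 = familyExponents m 2 + 1 := by
              have : 4 ≤ m ^ 2 := by nlinarith
              simp [familyExponents]
              omega
            rw [MonomialCurve.toricIdeal, RingHom.mem_ker, map_sub, map_mul, map_pow, map_pow,
              hX, hX, hX, h32, ← pow_mul, ← pow_mul, ← pow_add, sub_eq_zero]
            congr 1
            ring
          have := congrArg (algebraMap _ R) (Ideal.Quotient.eq.2 hker)
          rw [map_mul, map_mul, map_pow, map_pow, map_pow, map_pow] at this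
          exact this
        rw [RingHom.comp_apply, h1, map_pow]
        change (Polynomial.eval₂ (ψ.comp C) t Polynomial.X) ^ _ = _
        rw [Polynomial.eval₂_X, mul_pow, h3, mul_assoc, ← mul_pow, mul_comm (ψ (X 2)), hw2,
          one_pow, mul_one]
    exact fun f => congrArg (fun g => g f) this
  -- The maximal ideal contracts to a principal ideal of K[t]. Up to a unit, each element of R is
  -- the image of a polynomial in t, so the generator also generates the maximal ideal.
  obtain ⟨p, hp⟩ := (IsPrincipalIdealRing.principal ((IsLocalRing.maximalIdeal R).comap θ)).principal
  refine isGorensteinLocalRing_of_principal (p := θ p) (le_antisymm (fun r hr => ?_) ?_)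
  · obtain ⟨⟨x, s⟩, hxs⟩ := IsLocalization.surj P.primeCompl r
    obtain ⟨f, rfl⟩ := Ideal.Quotient.mk_surjective x
    have hs := IsLocalization.map_units R s
    have hxs' : r * algebraMap _ R s.1 = ψ f := hxs
    rw [← Ideal.mul_unit_mem_iff_mem _ hs, hxs', ← hθ]
    have hf : MonomialCurve.parametrization K (familyExponents m) f ∈
        (IsLocalRing.maximalIdeal R).comap θ := by
      rw [Ideal.mem_comap, hθ, ← hxs']
      exact Ideal.mul_mem_right _ _ hr
    rw [hp] at hf
    obtain ⟨q, hq⟩ := Ideal.mem_span_singleton'.1 hf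
    rw [← hq, map_mul]
    exact Ideal.mul_mem_left _ _ (Ideal.mem_span_singleton_self _)
  · rw [Ideal.span_singleton_le_iff_mem]
    have : p ∈ (IsLocalRing.maximalIdeal R).comap θ := by
      rw [hp]
      exact Ideal.mem_span_singleton_self p
    exact this

theorem isGorensteinRing_coordinateRing (hm : 4 ≤ m) :
    IsGorensteinRing (MonomialCurve.CoordinateRing K (familyExponents m)) := by
  refine ⟨inferInstance, fun P _ => ?_⟩
  by_cases hP : P = MonomialCurve.originIdeal K (familyExponents m)
  · subst hP
    exact (isGorensteinLocalRing_origin K hm _).1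
  · exact isGorensteinLocalRing_of_ne_origin hm P hP

end RossiCurve

/-! ### The main theorem -/

open MvPolynomial in
theorem mainTheorem12 (K : Type*) [Field K] (m : ℕ) (hm : 4 ≤ m) :
    -- the toric ideal is minimally generated by five explicit binomials
    IsMinimalGeneratingSet (MonomialCurve.toricIdeal K (familyExponents m))
      {X 0 ^ (m + 1) - X 1 * X 2, X 1 ^ m - X 0 * X 3, X 2 ^ 2 - X 1 ^ (m - 1) * X 3,
        X 3 ^ 2 - X 0 ^ m * X 2, X 0 ^ m * X 1 ^ (m - 1) - X 2 * X 3} ∧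
    -- the curve is Gorenstein but not a complete intersection
    ¬ IsCompleteIntersectionIdeal (MonomialCurve.toricIdeal K (familyExponents m)) ∧
    IsGorensteinRing (MonomialCurve.CoordinateRing K (familyExponents m)) ∧
    -- its local ring at the origin is a one-dimensional Gorenstein local ring
    IsGorensteinLocalRing (MonomialCurve.LocalRing K (familyExponents m)) ∧
    ringKrullDim (MonomialCurve.LocalRing K (familyExponents m)) = 1 ∧
    -- the tangent cone and its failure to be Cohen-Macaulay
    initialFormIdeal (MonomialCurve.toricIdeal K (familyExponents m)) =
      Ideal.span {X 1 * X 2, X 2 ^ 2, X 0 * X 3, X 2 * X 3, X 3 ^ 2, X 1 ^ m * X 3,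
        X 0 ^ (m + 2) * X 2, X 1 ^ (2 * m + 1)} ∧
    ¬ IsCohenMacaulayRing (MonomialCurve.TangentConeRing K (familyExponents m)) ∧
    -- the Hilbert series of the tangent cone, with nonnegative numerator
    (∃ g : Polynomial ℤ,
      g = 1 + 3 * Polynomial.X + ∑ i ∈ Finset.Icc 2 m, Polynomial.X ^ i +
        Polynomial.X ^ (m + 2) + ∑ i ∈ Finset.Icc (m + 4) (2 * m), Polynomial.X ^ i ∧
      (∀ k, 0 ≤ g.coeff k) ∧
      gradedHilbertSeries (initialFormIdeal (MonomialCurve.toricIdeal K (familyExponents m))) *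
        (1 - PowerSeries.X) = (g : PowerSeries ℤ)) ∧
    -- the Hilbert function of the local ring
    (∀ k, localHilbertFunction (MonomialCurve.LocalRing K (familyExponents m)) k =
      gradedHilbertFunction
        (initialFormIdeal (MonomialCurve.toricIdeal K (familyExponents m))) k) ∧
    Monotone (localHilbertFunction (MonomialCurve.LocalRing K (familyExponents m))) := by
  have hcone := RossiCurve.initialFormIdeal_toricIdeal (K := K) hm
  have hloc := RossiCurve.localHilbertFunction_eq K hm
    (R := MonomialCurve.LocalRing K (familyExponents m))
  obtain ⟨hgor, hdim⟩ := RossiCurve.isGorensteinLocalRing_origin K hm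
    (MonomialCurve.LocalRing K (familyExponents m))
  refine ⟨RossiCurve.isMinimalGeneratingSet_binomials hm,
    RossiCurve.not_isCompleteIntersectionIdeal hm,
    RossiCurve.isGorensteinRing_coordinateRing hm, hgor, hdim,
    hcone.trans (RossiCurve.coneIdeal_eq m), ?_, ?_, fun k => ?_, ?_⟩
  · change ¬ IsCohenMacaulayRing (_ ⧸ initialFormIdeal (MonomialCurve.toricIdeal K _))
    rw [hcone]
    exact RossiCurve.not_isCohenMacaulayRing hm
  · rw [hcone]
    exact RossiCurve.exists_hilbertNumerator hm
  · rw [hcone, hloc, RossiCurve.gradedHilbertFunction_coneIdeal]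
  · rw [funext hloc]
    exact RossiCurve.monotone_card_standardOfDegree hm
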